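/- Let $G$ be a locally compact group acting continuously on a (Hausdorff, paracompact, finite-dimensional) differentiable manifold $X$. Suppose that the action is $C^1$-continuous, i.e. each $g\in G$ is differentiable at each $x\in X$ and the derivative depends continuously on $(g,x)\in G\times X$. Suppose also that the action is (topologically) amenable, i.e. there is a net of non-negative continuous functions $\mu_i$ on $G\times X$ with $\int_G\mu_i(g,x)\,dg=1$ for all $i$ and $x$, and with $\lim_i\int_G|\mu_i(sg,sx)-\mu_i(g,x)|\,dg=0$ uniformly for $(s,x)$ in compact subsets of $G\times X$, where $dg$ is a left Haar measure. For $p\in\mathbf N$ let $\mathscr L^\infty(X^p)$ be the space of bounded Lebesgue measurable (real or complex) functions on the manifold $X^p$, and let $L^\infty(X^p)$ be its quotient by the functions vanishing locally almost everywhere with respect to Lebesgue measure; $[f]$ denotes the class of $f$. A strong linear lifting $L^\infty(X^p)\to\mathscr L^\infty(X^p)$ is a positive linear map $\lambda$ such that $[\lambda(\varphi)]=\varphi$ for all $\varphi$, $\lambda([\mathbf 1])=\mathbf 1$, and $\lambda([f])=f$ whenever $f\in\mathscr L^\infty(X^p)$ is continuous. The homogeneous coboundary maps $d\colon \mathscr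 L^\infty(X^p)\to\mathscr L^\infty(X^{p+1})$ and $d\colon L^\infty(X^p)\to L^\infty(X^{p+1})$ are given by $$(df)(x_0,\dots,x_p)=\sum_{j=0}^p(-1)^j f(x_0,\dots,x_{j-1},x_{j+1},\dots,x_p).$$ Then there is a family $(\lambda_p)_{p\in\mathbf N}$ of strong linear liftings $\lambda_p\colon L^\infty(X^p)\to\mathscr L^\infty(X^p)$ such that, for every $p$: 1. $\lambda_p$ is equivariant for the coordinatewise action of $G^p$ on $X^p$ (in particular for the diagonal action of $G$); 2. $\lambda_p$ commutes with all permutations of the coordinates of $X^p$; 3. $\lambda_{p+1}\circ d=d\circ\lambda_p$. -/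

import Mathlib

open MeasureTheory Filter Topology
open scoped Manifold

universe u v w k

noncomputable section

namespace EquivLifting

/-! ### The spaces `𝓛^∞(M)` and `L^∞(M)` of a manifold

`M` is modelled on a space `H` carrying a reference (Lebesgue) measure. Null sets and measurability
are read in the charts. For a `C¹` manifold modelled on `ℝⁿ` this is (local) negligibility and
(local) measurability for the Lebesgue measure of any Riemannian structure, since the latter has in
each chart a positive continuous density. -/

section Spaces

variable {𝕜 : Type*} [RCLike 𝕜] {H M : Type*} [TopologicalSpace H] [MeasureSpace H] [TopologicalSpace M]
  [ChartedSpace H M]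

variable (H) in
/-- A subset of a manifold is (locally) negligible if its image in each chart is a null set. -/
def IsNegligible (S : Set M) : Prop :=
  ∀ e ∈ atlas H M, volume (e.target ∩ e.symm ⁻¹' S) = 0

variable (H) in
/-- Lebesgue measurability on a manifold, read in the charts: `AEMeasurable` means measurable for
the completion, that is, in the sense of Lebesgue. -/
def IsLebesgueMeasurable (f : M → 𝕜) : Prop :=
  ∀ e ∈ atlas H M, AEMeasurable (fun v => f (e.symm v)) (volume.restrict e.target)

variable (𝕜 H M)

/-- `𝓛^∞(M)`: actual functions on `M` that are bounded and Lebesgue measurable. -/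
def CurlyLInfty : Submodule 𝕜 (M → 𝕜) where
  carrier := {f | IsLebesgueMeasurable H f ∧ ∃ C : ℝ, ∀ x, ‖f x‖ ≤ C}
  zero_mem' := ⟨fun _ _ => aemeasurable_const, 0, fun x => by simp⟩
  add_mem' := by
    rintro f g ⟨hf, C, hC⟩ ⟨hg, D, hD⟩
    exact ⟨fun e he => (hf e he).add (hg e he), C + D, fun x =>
      (norm_add_le _ _).trans (add_le_add (hC x) (hD x))⟩
  smul_mem' := by
    rintro c f ⟨hf, C, hC⟩
    refine ⟨fun e he => (hf e he).const_mul c, ‖c‖ * C, fun x => ?_⟩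
    simpa using mul_le_mul_of_nonneg_left (hC x) (norm_nonneg c)

/-- The functions in `𝓛^∞(M)` that vanish (locally) almost everywhere. -/
def nullFunctions : Submodule 𝕜 (CurlyLInfty 𝕜 H M) where
  carrier := {f | IsNegligible H {x | f.1 x ≠ 0}}
  zero_mem' := fun e _ => by simp
  add_mem' := by
    intro f g hf hg e he
    refine measure_mono_null ?_ (measure_union_null (hf e he) (hg e he))
    rintro v ⟨hv, h⟩
    by_cases h0 : f.1 (e.symm v) = 0
    · refine Or.inr ⟨hv, fun h1 => h ?_⟩
      change f.1 (e.symm v) + g.1 (e.symm v) = 0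
      rw [h0, h1, add_zero]
    · exact Or.inl ⟨hv, h0⟩
  smul_mem' := by
    intro c f hf e he
    refine measure_mono_null ?_ (hf e he)
    rintro v ⟨hv, h⟩
    refine ⟨hv, fun h0 => h ?_⟩
    change c • f.1 (e.symm v) = 0
    rw [h0, smul_zero]

/-- `L^∞(M)`: function classes, i.e. `𝓛^∞(M)` modulo (locally) almost everywhere equality. -/
abbrev LInfty : Type _ := CurlyLInfty 𝕜 H M ⧸ nullFunctions 𝕜 H M

variable {𝕜 H M}

/-- The class `[f]` of `f`. -/
def cls (f : CurlyLInfty 𝕜 H M) : LInfty 𝕜 H M := (nullFunctions 𝕜 H M).mkQ f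

theorem one_mem_curlyLInfty : (fun _ : M => (1 : 𝕜)) ∈ CurlyLInfty 𝕜 H M :=
  ⟨fun _ _ => aemeasurable_const, 1, fun _ => by simp⟩

/-- A strong linear lifting `L^∞(M) → 𝓛^∞(M)`. The inequality `0 ≤ z` in `𝕜` (real or complex) means
that `z` is real and non-negative. -/
structure IsStrongLinearLifting (L : LInfty 𝕜 H M →ₗ[𝕜] CurlyLInfty 𝕜 H M) : Prop where
  positive : ∀ f : CurlyLInfty 𝕜 H M,
    IsNegligible H {x | ¬ (0 ≤ RCLike.re (f.1 x) ∧ RCLike.im (f.1 x) = 0)} →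
      ∀ x, 0 ≤ RCLike.re ((L (cls f)).1 x) ∧ RCLike.im ((L (cls f)).1 x) = 0
  lifts : ∀ φ : LInfty 𝕜 H M, cls (L φ) = φ
  map_one : (L (cls ⟨fun _ => 1, one_mem_curlyLInfty⟩)).1 = fun _ => 1
  strong : ∀ f : CurlyLInfty 𝕜 H M, Continuous f.1 → L (cls f) = f

end Spaces

/-! ### Powers of a manifold -/

/-- The model space of the `p`-th power of an `n`-dimensional manifold. -/
abbrev ModelPow (n p : ℕ) : Type := ModelPi fun _ : Fin p => EuclideanSpace ℝ (Fin n)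

/-- Lebesgue measure on `(ℝⁿ)^p`. -/
instance (n p : ℕ) : MeasureSpace (ModelPow n p) :=
  inferInstanceAs (MeasureSpace (Fin p → EuclideanSpace ℝ (Fin n)))

section Powers

variable (𝕜 : Type*) [RCLike 𝕜] (n : ℕ) (X : Type*) [TopologicalSpace X]
  [ChartedSpace (EuclideanSpace ℝ (Fin n)) X]

/-- `𝓛^∞(X^p)`, where `X` is an `n`-dimensional manifold. -/
abbrev CurlyLInftyPow (p : ℕ) : Submodule 𝕜 ((Fin p → X) → 𝕜) :=
  CurlyLInfty 𝕜 (ModelPow n p) (Fin p → X)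

/-- `L^∞(X^p)`, where `X` is an `n`-dimensional manifold. -/
abbrev LInftyPow (p : ℕ) : Type _ := LInfty 𝕜 (ModelPow n p) (Fin p → X)

variable {𝕜 n X}

theorem quasiMeasurePreserving_comp_embedding {p q : ℕ} (σ : Fin p ↪ Fin q) :
    Measure.QuasiMeasurePreserving
      (fun v : Fin q → EuclideanSpace ℝ (Fin n) => fun i => v (σ i)) volume volume := by
  classical
  let P : Fin q → Prop := fun i => i ∈ Set.range σ
  let _ : Fintype {i // P i} := Subtype.fintype P
  let f : {i // P i} ≃ Fin p := (Equiv.ofInjective σ σ.injective).symm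
  have h1 := (volume_preserving_piEquivPiSubtypeProd
    (fun _ : Fin q => EuclideanSpace ℝ (Fin n)) P).quasiMeasurePreserving
  have h3 := (volume_measurePreserving_piCongrLeft
    (fun _ : Fin p => EuclideanSpace ℝ (Fin n)) f).quasiMeasurePreserving
  rw [Measure.volume_eq_prod] at h1
  have h := (h3.comp Measure.quasiMeasurePreserving_fst).comp h1
  suffices heq : (fun v : Fin q → EuclideanSpace ℝ (Fin n) => fun i => v (σ i)) = _ from heq ▸ h
  funext v i
  obtain ⟨a, rfl⟩ := f.surjective i
  simp only [Function.comp_apply]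
  erw [MeasurableEquiv.piCongrLeft_apply_apply]
  change v (σ ((Equiv.ofInjective σ σ.injective).symm a)) = v a
  exact congrArg v (Equiv.apply_ofInjective_symm σ.injective a)

/-- Reindexing a chart of a power gives a chart of the other power. -/
theorem exists_chart_comp_embedding {p q : ℕ} (σ : Fin p ↪ Fin q)
    {e : OpenPartialHomeomorph (Fin q → X) (ModelPow n q)}
    (he : e ∈ atlas (ModelPow n q) (Fin q → X)) :
    ∃ e' ∈ atlas (ModelPow n p) (Fin p → X),
      (∀ v, (fun i => e.symm v (σ i)) = e'.symm fun i => v (σ i)) ∧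
      ∀ v ∈ e.target, (fun i => v (σ i) : ModelPow n p) ∈ e'.target := by
  obtain ⟨c, hc, rfl⟩ := he
  exact ⟨OpenPartialHomeomorph.pi fun i => c (σ i), ⟨_, fun i _ => hc _ trivial, rfl⟩,
    fun v => rfl, fun v hv i _ => hv (σ i) trivial⟩

variable (𝕜 n X)

/-- For an injection `σ`, the map `𝓛^∞(X^p) → 𝓛^∞(X^q)` that sends `f` to
`x ↦ f (x_{σ 1}, …, x_{σ p})`. -/
def reindex {p q : ℕ} (σ : Fin p ↪ Fin q) :
    CurlyLInftyPow 𝕜 n X p →ₗ[𝕜] CurlyLInftyPow 𝕜 n X q where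
  toFun f := ⟨fun x => f.1 fun i => x (σ i), by
    obtain ⟨hf, C, hC⟩ := f.2
    refine ⟨fun e he => ?_, C, fun x => hC _⟩
    obtain ⟨e', he', h1, h2⟩ := exists_chart_comp_embedding σ he
    have := (hf e' he').comp_quasiMeasurePreserving
      ((quasiMeasurePreserving_comp_embedding σ).restrict h2)
    refine this.congr (Eventually.of_forall fun v => ?_)
    exact congrArg f.1 (h1 v).symm⟩
  map_add' _ _ := rfl
  map_smul' _ _ := rfl

/-- The map `L^∞(X^p) → L^∞(X^q)` induced by `reindex` on classes. -/
def reindexClass {p q : ℕ} (σ : Fin p ↪ Fin q) :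
    LInftyPow 𝕜 n X p →ₗ[𝕜] LInftyPow 𝕜 n X q :=
  Submodule.mapQ _ _ (reindex 𝕜 n X σ) (by
    intro f hf e he
    obtain ⟨e', he', h1, h2⟩ := exists_chart_comp_embedding σ he
    refine measure_mono_null ?_
      ((quasiMeasurePreserving_comp_embedding σ).preimage_null (hf e' he'))
    rintro v ⟨hv, h⟩
    refine ⟨h2 v hv, fun h0 => h ?_⟩
    exact (congrArg f.1 (h1 v)).trans h0)

/-- The homogeneous coboundary `d = ∑_{j=0}^p (-1)^j d_j : 𝓛^∞(X^p) → 𝓛^∞(X^{p+1})`, where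
`(d_j f) (x_0, …, x_p) = f (x_0, …, x_{j-1}, x_{j+1}, …, x_p)`. -/
def coboundary (p : ℕ) : CurlyLInftyPow 𝕜 n X p →ₗ[𝕜] CurlyLInftyPow 𝕜 n X (p + 1) :=
  ∑ j : Fin (p + 1), (-1 : 𝕜) ^ (j : ℕ) • reindex 𝕜 n X j.succAboveEmb

/-- The homogeneous coboundary `d = ∑_{j=0}^p (-1)^j d_j : L^∞(X^p) → L^∞(X^{p+1})`. -/
def coboundaryClass (p : ℕ) : LInftyPow 𝕜 n X p →ₗ[𝕜] LInftyPow 𝕜 n X (p + 1) :=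
  ∑ j : Fin (p + 1), (-1 : 𝕜) ^ (j : ℕ) • reindexClass 𝕜 n X j.succAboveEmb

variable {𝕜 n X}

/-- Equivariance of `L : L^∞(X^p) → 𝓛^∞(X^p)` under `G^p` acting coordinatewise on `X^p`: for
`g ∈ G^p` and `f ∈ 𝓛^∞(X^p)`, the translate `g f = f (g⁻¹ ·)` lies in `𝓛^∞(X^p)` and
`L [g f] = g (L [f])`. -/
def IsPowEquivariant (G : Type*) [Group G] [MulAction G X] {p : ℕ}
    (L : LInftyPow 𝕜 n X p →ₗ[𝕜] CurlyLInftyPow 𝕜 n X p) : Prop :=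
  ∀ (g : Fin p → G) (f : CurlyLInftyPow 𝕜 n X p),
    ∃ h : (fun x : Fin p → X => f.1 fun i => (g i)⁻¹ • x i) ∈ CurlyLInftyPow 𝕜 n X p,
      ∀ x : Fin p → X, (L (cls ⟨_, h⟩)).1 x = (L (cls f)).1 fun i => (g i)⁻¹ • x i

end Powers

/-! ### The hypotheses on the action -/

/-- A `C¹`-continuous action: each `g` is differentiable at each point of `X`, and the derivative
depends continuously on `(g, x)`, i.e. `(g, v) ↦ Dg (v)` is continuous on `G × TX`. (Continuity of
the action itself is `ContinuousSMul`.) -/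
structure IsC1Action (n : ℕ) (G X : Type*) [TopologicalSpace G] [Group G] [TopologicalSpace X]
    [ChartedSpace (EuclideanSpace ℝ (Fin n)) X] [IsManifold (𝓡 n) 1 X] [MulAction G X] : Prop where
  differentiable : ∀ g : G, MDifferentiable (𝓡 n) (𝓡 n) fun x : X => g • x
  continuous_derivative :
    Continuous fun q : G × TangentBundle (𝓡 n) X =>
      tangentMap (𝓡 n) (𝓡 n) (fun x : X => q.1 • x) q.2

/-- Topological amenability of an action of a locally compact group: there is a net of
non-negative continuous functions `μ_i` on `G × X` such that `∫ μ_i (g, x) dg = 1` for all `i`, `x`,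
and `∫ |μ_i (s g, s x) - μ_i (g, x)| dg → 0` uniformly for `(s, x)` in compact subsets of `G × X`.
Here `dg` is a left Haar measure. -/
def IsAmenableAction (G : Type u) (X : Type v) [TopologicalSpace G] [Group G]
    [IsTopologicalGroup G] [LocallyCompactSpace G] [MeasurableSpace G] [BorelSpace G]
    [TopologicalSpace X] [MulAction G X] : Prop :=
  ∃ (I : Type w) (_ : Preorder I) (_ : Nonempty I) (_ : IsDirected I (· ≤ ·))
    (μ : I → G → X → ℝ),
    (∀ i, Continuous fun q : G × X => μ i q.1 q.2) ∧
    (∀ i g x, 0 ≤ μ i g x) ∧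
    (∀ i x, ∫ g, μ i g x ∂Measure.haar = 1) ∧
    ∀ K : Set (G × X), IsCompact K →
      TendstoUniformlyOn
        (fun i (q : G × X) => ∫ g, |μ i (q.1 * g) (q.1 • q.2) - μ i g q.2| ∂Measure.haar)
        (fun _ => 0) atTop K

end EquivLifting

end

open EquivLifting

open Set
open scoped Pointwise

/-! The lifting of `f` at a point is a limit of averages of `f` over small neighbourhoods; Lebesgue
differentiation makes it agree with `f` almost everywhere. Balls in charts are not equivariant, so
the charts are transported by the action and averaged over `G` with the amenability densities. For
`x ∈ X`, draw `g` with density `μ_i(g, x)` and `w` uniformly in the unit ball, displace `g⁻¹x` by `t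
w` in a chart selected at `g⁻¹x`, and apply `g`. Before the last step only `g⁻¹x` matters, so
replacing `(g, x)` by `(sg, sx)` moves the sampled point by `s` (`samplePoint_smul`). On `X^p` the
coordinates are sampled independently.

Convergence: for fixed `g`, the action in charts is a `C¹` diffeomorphism. It sends a ball of radius
`r` into one of radius `Lr` and distorts volume by a bounded factor, hence preserves Lebesgue points
(`tendsto_average_comp_of_hasStrictFDerivAt`). As `t → 0` the averages therefore converge to `f` at
every Lebesgue point of `f` in a chart, for all `i` at once (`isNegligible_not_tendsto_avg`).

Algebra: independence makes the average of a function that ignores some coordinates equal to the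
average over the others, up to a mass tending to `1`. This single fact
(`tendsto_avg_comp_embedding_sub`) yields both the permutations and the coboundary.

Equivariance: by amenability, the law of `g` at `x` and the `s`-translate of its law at `s⁻¹x` share
a minorant of mass close to `1`. Products of such laws are then close too, with a different `s`
allowed in each coordinate (`eventually_norm_avg_sub_le`).

The lifting is the limit along an ultrafilter on pairs `(i, t)` for which `t → 0` at fixed `i` comes
first, then the limit in `i`. -/

namespace EquivLifting

/-! ### The action read in charts is `C¹` -/

section Charts

variable {G X E : Type*} [Group G] [TopologicalSpace X] [MulAction G X]
  [ContinuousConstSMul G X] [TopologicalSpace E]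

/-- The transformation `x ↦ g • x` read in the charts `c` and `c'`. -/
def chartAction (g : G) (c c' : OpenPartialHomeomorph X E) : OpenPartialHomeomorph E E :=
  (c.symm.transHomeomorph (Homeomorph.smul g)).trans c'

theorem mem_chartAction_source {g : G} {c c' : OpenPartialHomeomorph X E} {v : E} :
    v ∈ (chartAction g c c').source ↔ v ∈ c.target ∧ g • c.symm v ∈ c'.source := Iff.rfl

theorem chartAction_target (g : G) (c c' : OpenPartialHomeomorph X E) :
    (chartAction g c c').target = (chartAction g⁻¹ c' c).source := by
  ext v
  simp [chartAction]

variable {n : ℕ} [TopologicalSpace G] [ChartedSpace (EuclideanSpace ℝ (Fin n)) X] [IsManifold (𝓡 n) 1 X]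

omit [ContinuousConstSMul G X] in
variable (G) in
-- By the chain rule, the tangent map of the action in charts is a composite of continuous tangent
-- maps. Its fibre component at a fixed vector is the derivative applied to that vector.
theorem IsC1Action.contDiffOn_chart (h : IsC1Action n G X) (g : G)
    {c c' : OpenPartialHomeomorph X (EuclideanSpace ℝ (Fin n))}
    (hc : c ∈ atlas (EuclideanSpace ℝ (Fin n)) X) (hc' : c' ∈ atlas (EuclideanSpace ℝ (Fin n)) X)
    {O : Set (EuclideanSpace ℝ (Fin n))}
    (hOs : ∀ v ∈ O, v ∈ c.target ∧ g • c.symm v ∈ c'.source) :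
    DifferentiableOn ℝ (fun v => c' (g • c.symm v)) O ∧
      ContinuousOn (fderiv ℝ (fun v => c' (g • c.symm v))) O := by
  have hcm := IsManifold.subset_maximalAtlas (I := 𝓡 n) (n := 1) hc
  have hcm' := IsManifold.subset_maximalAtlas (I := 𝓡 n) (n := 1) hc'
  have h1 : ContMDiffOn (𝓡 n) (𝓡 n) 1 c.symm c.target := contMDiffOn_symm_of_mem_maximalAtlas hcm
  have h2 : ContMDiffOn (𝓡 n) (𝓡 n) 1 c' c'.source := contMDiffOn_of_mem_maximalAtlas hcm'
  set ψ : EuclideanSpace ℝ (Fin n) → EuclideanSpace ℝ (Fin n) := fun v => c' (g • c.symm v)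
  have hm1 : ∀ v ∈ O, MDifferentiableAt (𝓡 n) (𝓡 n) c.symm v := fun v hv =>
    ((h1.contMDiffAt (c.open_target.mem_nhds (hOs v hv).1))).mdifferentiableAt (by simp)
  have hm2 : ∀ v ∈ O, MDifferentiableAt (𝓡 n) (𝓡 n) c' (g • c.symm v) := fun v hv =>
    ((h2.contMDiffAt (c'.open_source.mem_nhds (hOs v hv).2))).mdifferentiableAt (by simp)
  have hm3 : ∀ v ∈ O, MDifferentiableAt (𝓡 n) (𝓡 n) ψ v := fun v hv =>
    (hm2 v hv).comp v ((h.differentiable g _).comp v (hm1 v hv))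
  have hd : ∀ v ∈ O, DifferentiableAt ℝ ψ v := fun v hv => (hm3 v hv).differentiableAt
  refine ⟨fun v hv => (hd v hv).differentiableWithinAt, ?_⟩
  have t1 : ContinuousOn (tangentMapWithin (𝓡 n) (𝓡 n) c.symm c.target) _ :=
    h1.continuousOn_tangentMapWithin le_rfl c.open_target.uniqueMDiffOn
  have t2 : ContinuousOn (tangentMapWithin (𝓡 n) (𝓡 n) c' c'.source) _ :=
    h2.continuousOn_tangentMapWithin le_rfl c'.open_source.uniqueMDiffOn
  have t3 : Continuous fun q : TangentBundle (𝓡 n) X =>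
      tangentMap (𝓡 n) (𝓡 n) (fun x : X => g • x) q :=
    h.continuous_derivative.comp (Continuous.prodMk_right g)
  have key : ContinuousOn (fun q : TangentBundle (𝓡 n) (EuclideanSpace ℝ (Fin n)) =>
      tangentMap (𝓡 n) (𝓡 n) ψ q) (Bundle.TotalSpace.proj ⁻¹' O) := by
    have := t2.comp (t3.comp_continuousOn (t1.mono (t := Bundle.TotalSpace.proj ⁻¹' O)
      (fun q hq => (hOs _ hq).1))) (fun q hq => (hOs _ hq).2)
    refine this.congr fun q hq => ?_
    have e1 : tangentMapWithin (𝓡 n) (𝓡 n) c.symm c.target q =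
        tangentMap (𝓡 n) (𝓡 n) c.symm q :=
      tangentMapWithin_eq_tangentMap (c.open_target.uniqueMDiffOn _ (hOs _ hq).1) (hm1 _ hq)
    have e2 : tangentMapWithin (𝓡 n) (𝓡 n) c' c'.source (tangentMap (𝓡 n) (𝓡 n)
        (fun x : X => g • x) (tangentMap (𝓡 n) (𝓡 n) c.symm q)) = tangentMap (𝓡 n) (𝓡 n) c'
        (tangentMap (𝓡 n) (𝓡 n) (fun x : X => g • x) (tangentMap (𝓡 n) (𝓡 n) c.symm q)) :=
      tangentMapWithin_eq_tangentMap (c'.open_source.uniqueMDiffOn _ (hOs _ hq).2) (hm2 _ hq)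
    have e3 := tangentMap_comp_at q (h.differentiable g (c.symm q.proj)) (hm1 _ hq)
    have e4 := tangentMap_comp_at q (hm2 _ hq) ((h.differentiable g _).comp q.proj (hm1 _ hq))
    simp only [Function.comp_apply, e1]
    rw [e2, ← e3, ← e4]
    rfl
  have hfd : ∀ w, ContinuousOn (fun v => fderiv ℝ ψ v w) O := by
    intro w
    have s1 : Continuous fun v : EuclideanSpace ℝ (Fin n) =>
        (tangentBundleModelSpaceHomeomorph (𝓡 n)).symm (v, w) :=
      (tangentBundleModelSpaceHomeomorph (𝓡 n)).symm.continuous.comp (Continuous.prodMk_left w)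
    have s2 := (continuous_snd (X := EuclideanSpace ℝ (Fin n))
      (Y := EuclideanSpace ℝ (Fin n))).comp_continuousOn
      ((tangentBundleModelSpaceHomeomorph (𝓡 n)).continuous.comp_continuousOn
      (key.comp s1.continuousOn (t := Bundle.TotalSpace.proj ⁻¹' O) (s := O) fun v hv => hv))
    refine s2.congr fun v hv => ?_
    change _ = mfderiv (𝓡 n) (𝓡 n) ψ v w
    rw [mfderiv_eq_fderiv]
    rfl
  -- In finite dimension, continuity on each vector gives continuity in operator norm.
  exact continuousOn_clm_apply.2 hfd

variable (G) in
theorem IsC1Action.hasStrictFDerivAt_chartAction (h : IsC1Action n G X) (g : G)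
    {c c' : OpenPartialHomeomorph X (EuclideanSpace ℝ (Fin n))}
    (hc : c ∈ atlas (EuclideanSpace ℝ (Fin n)) X) (hc' : c' ∈ atlas (EuclideanSpace ℝ (Fin n)) X)
    {v : EuclideanSpace ℝ (Fin n)} (hv : v ∈ (chartAction g c c').source) :
    HasStrictFDerivAt (chartAction g c c') (fderiv ℝ (chartAction g c c') v) v := by
  obtain ⟨h1, h2⟩ := h.contDiffOn_chart G g hc hc' fun v hv => hv
  refine hasStrictFDerivAt_of_hasFDerivAt_of_continuousAt ?_
    (h2.continuousAt ((chartAction g c c').open_source.mem_nhds hv))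
  filter_upwards [(chartAction g c c').open_source.mem_nhds hv] with y hy
  exact (h1.differentiableAt ((chartAction g c c').open_source.mem_nhds hy)).hasFDerivAt

variable (G) in
theorem IsC1Action.differentiableOn_chartAction (h : IsC1Action n G X) (g : G)
    {c c' : OpenPartialHomeomorph X (EuclideanSpace ℝ (Fin n))}
    (hc : c ∈ atlas (EuclideanSpace ℝ (Fin n)) X)
    (hc' : c' ∈ atlas (EuclideanSpace ℝ (Fin n)) X) :
    DifferentiableOn ℝ (chartAction g c c') (chartAction g c c').source :=
  (h.contDiffOn_chart G g hc hc' fun _ hv => hv).1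

variable (G) in
theorem IsC1Action.differentiableOn_pi_chartAction_symm (h : IsC1Action n G X) {p : ℕ}
    (g : Fin p → G) {c c' : Fin p → OpenPartialHomeomorph X (EuclideanSpace ℝ (Fin n))}
    (hc : ∀ j, c j ∈ atlas (EuclideanSpace ℝ (Fin n)) X)
    (hc' : ∀ j, c' j ∈ atlas (EuclideanSpace ℝ (Fin n)) X) :
    DifferentiableOn ℝ (OpenPartialHomeomorph.pi fun j => chartAction (g j) (c j) (c' j)).symm
      (OpenPartialHomeomorph.pi fun j => chartAction (g j) (c j) (c' j)).target := by
  refine differentiableOn_pi.2 fun j => ?_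
  refine DifferentiableOn.comp (g := chartAction (g j)⁻¹ (c' j) (c j))
    (f := fun y : Fin p → EuclideanSpace ℝ (Fin n) => y j)
    (h.differentiableOn_chartAction G (g j)⁻¹ (hc' j) (hc j))
    (differentiable_apply j).differentiableOn fun y hy => ?_
  rw [← chartAction_target]
  exact hy j trivial

end Charts
-- Finite products of measures: domination, marginals, comparison
section ProductMeasures

theorem pi_mono {ι : Type*} [Fintype ι] {α : ι → Type*} [∀ i, MeasurableSpace (α i)]
    {μ ν : ∀ i, Measure (α i)} [∀ i, SigmaFinite (μ i)] (h : ∀ i, μ i ≤ ν i) :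
    Measure.pi μ ≤ Measure.pi ν := by
  refine Measure.le_intro fun s _ _ => ?_
  rw [Measure.pi_def ν]
  refine le_trans ?_ (le_toMeasure_apply (OuterMeasure.pi fun i => (ν i).toOuterMeasure)
    (Measure.pi_caratheodory ν) s)
  refine (OuterMeasure.le_pi (n := (Measure.pi μ).toOuterMeasure)).2 (fun t _ => ?_) s
  change Measure.pi μ _ ≤ _
  rw [Measure.pi_pi]
  exact Finset.prod_le_prod' fun i _ => h i _

theorem pi_absolutelyContinuous {p : ℕ} {α : Type*} [MeasurableSpace α]
    {μ ν : Fin p → Measure α} [∀ i, SigmaFinite (μ i)] [∀ i, SigmaFinite (ν i)]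
    (h : ∀ i, μ i ≪ ν i) : Measure.pi μ ≪ Measure.pi ν := by
  induction p with
  | zero =>
    rw [Measure.pi_of_empty (μ := μ) finZeroElim, Measure.pi_of_empty (μ := ν) finZeroElim]
  | succ p ih =>
    have h1 := (measurePreserving_piFinSuccAbove μ 0)
    have h2 := (measurePreserving_piFinSuccAbove ν 0)
    have h3 := (h 0).prod (ih (μ := fun i => μ (Fin.succAbove 0 i))
      (ν := fun i => ν (Fin.succAbove 0 i)) fun i => h _)
    rw [← h1.symm.map_eq, ← h2.symm.map_eq]
    exact h3.map h1.symm.measurable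

/-- The marginal of a product. The forgotten factors contribute their total masses, which need not
be `1` because the sampling laws are only sub-probabilities. -/
theorem pi_map_comp_embedding {p q : ℕ} (σ : Fin p ↪ Fin q) {α : Type*} [MeasurableSpace α]
    (μ : Fin q → Measure α) [∀ i, IsFiniteMeasure (μ i)] :
    (Measure.pi μ).map (fun v i => v (σ i)) =
      (∏ j : {j // j ∉ Set.range σ}, μ j univ) • Measure.pi fun i => μ (σ i) := by
  classical
  let P : Fin q → Prop := fun i => i ∈ Set.range σ
  let _ : Fintype {i // P i} := Subtype.fintype P
  let f : {i // P i} ≃ Fin p := (Equiv.ofInjective σ σ.injective).symm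
  have h1 := measurePreserving_piEquivPiSubtypeProd μ P
  have h3 := measurePreserving_piCongrLeft (fun i => μ (σ i)) f
  have hf : ∀ j : {i // P i}, σ (f j) = j := fun j => Equiv.apply_ofInjective_symm σ.injective j
  simp only [hf] at h3
  have heq : (fun (v : Fin q → α) (i : Fin p) => v (σ i)) =
      (MeasurableEquiv.piCongrLeft (fun _ => α) f ∘ Prod.fst) ∘
        MeasurableEquiv.piEquivPiSubtypeProd (fun _ => α) P := by
    funext v i
    obtain ⟨a, rfl⟩ := f.surjective i
    simp only [Function.comp_apply]
    erw [MeasurableEquiv.piCongrLeft_apply_apply]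
    exact congrArg v (hf a)
  rw [heq, ← Measure.map_map (h3.measurable.comp measurable_fst) h1.measurable, h1.map_eq,
    ← Measure.map_map h3.measurable measurable_fst, Measure.map_fst_prod, Measure.map_smul,
    h3.map_eq, Measure.pi_univ]

theorem norm_integral_sub_le_of_le {α 𝕜 : Type*} [RCLike 𝕜] [MeasurableSpace α]
    {μ κ : Measure α} [IsFiniteMeasure μ] (h : κ ≤ μ) {F : α → 𝕜}
    (hF : AEStronglyMeasurable F μ) {C : ℝ} (hC : ∀ x, ‖F x‖ ≤ C) :
    ‖∫ x, F x ∂μ - ∫ x, F x ∂κ‖ ≤ C * (μ.real univ - κ.real univ) := by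
  have : IsFiniteMeasure κ := isFiniteMeasure_of_le μ h
  have hle : μ - κ ≤ μ := Measure.sub_le
  have : IsFiniteMeasure (μ - κ) := isFiniteMeasure_of_le μ hle
  have hi : Integrable F μ := .of_bound hF C (.of_forall hC)
  have hadd : μ = (μ - κ) + κ := (Measure.sub_add_cancel_of_le h).symm
  have e1 : ∫ x, F x ∂μ = ∫ x, F x ∂(μ - κ) + ∫ x, F x ∂κ := by
    conv_lhs => rw [hadd]
    exact integral_add_measure (hi.mono_measure hle) (hi.mono_measure h)
  have e2 : μ.real univ = (μ - κ).real univ + κ.real univ := by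
    conv_lhs => rw [hadd]
    exact measureReal_add_apply
  rw [e1, e2, add_sub_cancel_right, add_sub_cancel_right]
  exact norm_integral_le_of_norm_le_const (.of_forall hC)

/-- Both products dominate the product of the `κ i`. Each integral differs from the one against that
minorant by at most `C` times the missing mass. -/
theorem norm_integral_pi_sub_le {p : ℕ} {α 𝕜 : Type*} [RCLike 𝕜] [MeasurableSpace α]
    {μ ν κ : Fin p → Measure α} [∀ i, IsFiniteMeasure (μ i)] [∀ i, IsFiniteMeasure (ν i)]
    (h1 : ∀ i, κ i ≤ μ i) (h2 : ∀ i, κ i ≤ ν i) (hμ : ∀ i, μ i univ ≤ 1) (hν : ∀ i, ν i univ ≤ 1)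
    {F : (Fin p → α) → 𝕜} (hFμ : AEStronglyMeasurable F (Measure.pi μ))
    (hFν : AEStronglyMeasurable F (Measure.pi ν)) {C : ℝ} (hC : ∀ x, ‖F x‖ ≤ C) (hC0 : 0 ≤ C) :
    ‖∫ x, F x ∂Measure.pi μ - ∫ x, F x ∂Measure.pi ν‖ ≤
      2 * C * (1 - ∏ i, (κ i).real univ) := by
  have : ∀ i, IsFiniteMeasure (κ i) := fun i => isFiniteMeasure_of_le _ (h1 i)
  have a1 := norm_integral_sub_le_of_le (pi_mono h1) hFμ hC
  have a2 := norm_integral_sub_le_of_le (pi_mono h2) hFν hC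
  have e : (Measure.pi κ).real univ = ∏ i, (κ i).real univ := by
    simp [Measure.real, Measure.pi_univ, ENNReal.toReal_prod]
  have b : ∀ ρ : Fin p → Measure α, (∀ i, IsFiniteMeasure (ρ i)) → (∀ i, ρ i univ ≤ 1) →
      (Measure.pi ρ).real univ ≤ 1 := by
    intro ρ _ h
    rw [Measure.real, Measure.pi_univ]
    exact ENNReal.toReal_le_of_le_ofReal zero_le_one (by simpa using Finset.prod_le_one' fun i _ => h i)
  have c1 := mul_le_mul_of_nonneg_left (sub_le_sub_right (b μ inferInstance hμ)
    ((Measure.pi κ).real univ)) hC0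
  have c2 := mul_le_mul_of_nonneg_left (sub_le_sub_right (b ν inferInstance hν)
    ((Measure.pi κ).real univ)) hC0
  rw [e] at a1 a2 c1 c2
  calc _ = ‖(∫ x, F x ∂Measure.pi μ - ∫ x, F x ∂Measure.pi κ) -
        (∫ x, F x ∂Measure.pi ν - ∫ x, F x ∂Measure.pi κ)‖ := by rw [sub_sub_sub_cancel_right]
    _ ≤ _ := (norm_sub_le _ _).trans (by linarith)

end ProductMeasures

/-! ### Null sets and Lebesgue points under `C¹` changes of variables -/

section LebesguePoints

variable {E : Type*} [NormedAddCommGroup E] [NormedSpace ℝ E] [FiniteDimensional ℝ E]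
  [MeasurableSpace E] [BorelSpace E] {μ : Measure E} [μ.IsAddHaarMeasure]

theorem measure_source_inter_preimage_eq_zero (ψ : OpenPartialHomeomorph E E)
    (h : DifferentiableOn ℝ ψ.symm ψ.target) {N : Set E} (hN : μ N = 0) :
    μ (ψ.source ∩ ψ ⁻¹' N) = 0 := by
  refine measure_mono_null ?_ (addHaar_image_eq_zero_of_differentiableOn_of_addHaar_eq_zero μ
    (h.mono inter_subset_left) (measure_mono_null (inter_subset_right (s := ψ.target)) hN))
  rintro x ⟨hx, hxN⟩
  exact ⟨ψ x, ⟨ψ.map_source hx, hxN⟩, ψ.left_inv hx⟩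

/-- A Lipschitz bound for `ψ` controls the radius of the image ball; a Jacobian bound for `ψ.symm`
near `ψ a` controls the density of the pushed-forward measure. -/
theorem eventually_map_restrict_closedBall_le (ψ : OpenPartialHomeomorph E E) {a : E}
    (ha : a ∈ ψ.source) {A B : E →L[ℝ] E} (hA : HasStrictFDerivAt ψ A a)
    (hB : HasStrictFDerivAt ψ.symm B (ψ a)) :
    ∃ L > (0 : ℝ), ∃ m : NNReal, ∀ᶠ r in 𝓝[>] (0 : ℝ), Metric.closedBall a r ⊆ ψ.source ∧
      (μ.restrict (Metric.closedBall a r)).map ψ ≤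
        (m : ENNReal) • μ.restrict (Metric.closedBall (ψ a) (L * r)) := by
  obtain ⟨K, s, hs, hK⟩ := hA.exists_lipschitzOnWith
  obtain ⟨m, hm⟩ := ENNReal.lt_iff_exists_nnreal_btwn.1
    (ENNReal.ofReal_lt_top : ENNReal.ofReal |B.det| < ⊤)
  -- Any map that is `δ`-close to the linear map `B` expands volume by at most `m`, where `m > |det
  -- B|`.
  obtain ⟨δ, hδ, hδ0⟩ := ((addHaar_image_le_mul_of_det_lt μ B hm.1).and self_mem_nhdsWithin).exists
  obtain ⟨t, ht, htB⟩ := hB.approximates_deriv_on_nhds (c := δ) (Or.inr hδ0)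
  -- The Lipschitz constant `K` may vanish; `K + 1` is positive.
  refine ⟨K + 1, by positivity, m, ?_⟩
  have hnh : s ∩ (ψ.source ∩ ψ ⁻¹' t) ∈ 𝓝 a :=
    inter_mem hs (inter_mem (ψ.open_source.mem_nhds ha) (ψ.continuousAt ha ht))
  obtain ⟨ε, hε, hball⟩ := Metric.nhds_basis_closedBall.mem_iff.1 hnh
  filter_upwards [Ioo_mem_nhdsGT hε] with r hr
  have hsub : Metric.closedBall a r ⊆ s ∩ (ψ.source ∩ ψ ⁻¹' t) :=
    (Metric.closedBall_subset_closedBall hr.2.le).trans hball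
  have hsrc : Metric.closedBall a r ⊆ ψ.source := fun y hy => (hsub hy).2.1
  have hmeas : AEMeasurable ψ (μ.restrict (Metric.closedBall a r)) :=
    (ψ.continuousOn.mono hsrc).aemeasurable Metric.isClosed_closedBall.measurableSet
  refine ⟨hsrc, Measure.le_intro fun S hS _ => ?_⟩
  rw [Measure.map_apply_of_aemeasurable hmeas hS, Measure.restrict_apply'
    Metric.isClosed_closedBall.measurableSet, Measure.smul_apply, Measure.restrict_apply hS,
    smul_eq_mul]
  have haB : a ∈ Metric.closedBall a r := Metric.mem_closedBall_self hr.1.le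
  calc μ (ψ ⁻¹' S ∩ Metric.closedBall a r)
      ≤ μ (ψ.symm '' (ψ '' (ψ ⁻¹' S ∩ Metric.closedBall a r))) := by
        refine measure_mono fun y hy => ⟨ψ y, ⟨y, hy, rfl⟩, ψ.left_inv (hsrc hy.2)⟩
    _ ≤ m * μ (ψ '' (ψ ⁻¹' S ∩ Metric.closedBall a r)) := by
        refine hδ _ _ (htB.mono_set ?_)
        rintro _ ⟨y, hy, rfl⟩
        exact (hsub hy.2).2.2
    _ ≤ _ := by
        gcongr
        rintro _ ⟨y, hy, rfl⟩
        refine ⟨hy.1, Metric.mem_closedBall.2 ?_⟩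
        have h1 := hK.dist_le_mul y (hsub hy.2).1 a (hsub haB).1
        have h2 : dist y a ≤ r := hy.2
        have h3 : (K : ℝ) * dist y a ≤ K * r := by gcongr
        linarith [hr.1]

/-- Lebesgue points are invariant: the average over `B(a, r)` is at most `m L^dim` times the average
of `‖h - c‖` over `B(ψ a, L r)`, the power of `L` being the ratio of the two volumes. -/
theorem tendsto_average_comp_of_hasStrictFDerivAt {𝕜 : Type*} [RCLike 𝕜]
    (ψ : OpenPartialHomeomorph E E) {a : E}
    (ha : a ∈ ψ.source) {A B : E →L[ℝ] E} (hA : HasStrictFDerivAt ψ A a)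
    (hB : HasStrictFDerivAt ψ.symm B (ψ a)) {h : E → 𝕜} (hm : AEStronglyMeasurable h μ)
    {C : ℝ} (hC : ∀ x, ‖h x‖ ≤ C) {c : 𝕜}
    (hL : Tendsto (fun r => ⨍ y in Metric.closedBall (ψ a) r, ‖h y - c‖ ∂μ) (𝓝[>] 0) (𝓝 0)) :
    Tendsto (fun r => ⨍ y in Metric.closedBall a r, ‖h (ψ y) - c‖ ∂μ) (𝓝[>] 0) (𝓝 0) := by
  obtain ⟨L, hL0, m, hev⟩ := eventually_map_restrict_closedBall_le (μ := μ) ψ ha hA hB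
  have hscale : Tendsto (fun r => L * r) (𝓝[>] (0 : ℝ)) (𝓝[>] 0) := by
    refine tendsto_nhdsWithin_iff.2 ⟨?_, ?_⟩
    · have : Tendsto (fun r => L * r) (𝓝 (0 : ℝ)) (𝓝 (L * 0)) := (continuous_const_mul L).tendsto 0
      rw [mul_zero] at this
      exact this.mono_left nhdsWithin_le_nhds
    · filter_upwards [self_mem_nhdsWithin] with r hr using mul_pos hL0 hr
  have hlim := (hL.comp hscale).const_mul ((m : ℝ) * L ^ Module.finrank ℝ E)
  rw [mul_zero] at hlim
  refine tendsto_of_tendsto_of_tendsto_of_le_of_le' tendsto_const_nhds hlim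
    (.of_forall fun r => integral_nonneg fun y => norm_nonneg _) ?_
  filter_upwards [hev, self_mem_nhdsWithin] with r hr hr0
  have hr0 : 0 < r := hr0
  have hint : Integrable (fun y => ‖h y - c‖)
      ((m : ENNReal) • μ.restrict (Metric.closedBall (ψ a) (L * r))) := by
    refine Integrable.smul_measure ?_ ENNReal.coe_ne_top
    have : IsFiniteMeasure (μ.restrict (Metric.closedBall (ψ a) (L * r))) :=
      ⟨by simpa using measure_closedBall_lt_top⟩
    refine .of_bound (hm.restrict.sub aestronglyMeasurable_const).norm (C + ‖c‖) (.of_forall ?_)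
    intro y
    rw [norm_norm]
    exact (norm_sub_le _ _).trans (by gcongr; exact hC y)
  have hmeas : AEMeasurable ψ (μ.restrict (Metric.closedBall a r)) :=
    (ψ.continuousOn.mono hr.1).aemeasurable Metric.isClosed_closedBall.measurableSet
  have e1 : ∫ y in Metric.closedBall a r, ‖h (ψ y) - c‖ ∂μ ≤
      m * ∫ y in Metric.closedBall (ψ a) (L * r), ‖h y - c‖ ∂μ := by
    rw [← integral_map (f := fun y => ‖h y - c‖) hmeas (hint.mono_measure hr.2).1]
    refine (integral_mono_measure hr.2 (.of_forall fun y => norm_nonneg _) hint).trans ?_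
    rw [integral_smul_measure]
    simp
  simp only [Function.comp_apply, setAverage_eq, smul_eq_mul]
  have e2 : μ.real (Metric.closedBall (ψ a) (L * r)) =
      L ^ Module.finrank ℝ E * μ.real (Metric.closedBall a r) := by
    rw [Measure.addHaar_real_closedBall _ _ (by positivity),
      Measure.addHaar_real_closedBall _ _ hr0.le, mul_pow, mul_assoc]
  rw [e2]
  have hpos : 0 < μ.real (Metric.closedBall a r) :=
    ENNReal.toReal_pos (Metric.measure_closedBall_pos μ a hr0).ne' measure_closedBall_lt_top.ne
  have : (m : ℝ) * L ^ Module.finrank ℝ E * ((L ^ Module.finrank ℝ E *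
      μ.real (Metric.closedBall a r))⁻¹ * ∫ y in Metric.closedBall (ψ a) (L * r), ‖h y - c‖ ∂μ) =
      (μ.real (Metric.closedBall a r))⁻¹ *
        (m * ∫ y in Metric.closedBall (ψ a) (L * r), ‖h y - c‖ ∂μ) := by
    field_simp
  rw [this]
  gcongr

theorem setAverage_closedBall_eq (a : E) {r : ℝ} (hr : 0 < r) (h : E → ℝ) :
    ⨍ y in Metric.closedBall a r, h y ∂μ =
      ⨍ w in Metric.closedBall 0 1, h (a + r • w) ∂μ := by
  have h1 : ∫ y in Metric.closedBall a r, h y ∂μ =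
      ∫ y in Metric.closedBall 0 r, h (a + y) ∂μ := by
    rw [← (measurePreserving_add_left μ a).setIntegral_preimage_emb
      (measurableEmbedding_addLeft a)]
    simp
  have h2 : r • Metric.closedBall (0 : E) 1 = Metric.closedBall 0 r := by
    rw [smul_closedBall _ _ zero_le_one]; simp [abs_of_pos hr]
  have h3 := Measure.setIntegral_comp_smul_of_pos μ (fun y => h (a + y)) (Metric.closedBall 0 1) hr
  rw [h2] at h3
  rw [setAverage_eq, setAverage_eq, h1, h3, Measure.addHaar_real_closedBall' _ _ hr.le]
  simp only [smul_eq_mul, mul_inv]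
  ring

end LebesguePoints
-- Chart selection and random points near `x`
section Sampling

variable {G X E : Type*} [TopologicalSpace X] [NormedAddCommGroup E] [NormedSpace ℝ E]
  [ChartedSpace E X]

omit [NormedSpace ℝ E] in
variable (E X) in
-- Take a locally finite open refinement `V` of the chart domains and well-order the indices; select
-- the least `b` with `z ∈ V b`. Local finiteness leaves finitely many choices on a compact set.
theorem exists_chart_selection [T2Space X] [ParacompactSpace X] :
    ∃ a : X → X, (∀ z, z ∈ (chartAt E (a z)).source) ∧
      (∀ b, MeasurableSet[borel X] {z | a z = b}) ∧
      ∀ K : Set X, IsCompact K → (a '' K).Finite := by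
  obtain ⟨V, hVo, hVc, hVf, hVs⟩ := precise_refinement (fun b : X => (chartAt E b).source)
    (fun b => (chartAt E b).open_source)
    (eq_univ_of_forall fun x => mem_iUnion.2 ⟨x, mem_chart_source E x⟩)
  have hne : ∀ z, {b | z ∈ V b}.Nonempty := fun z => mem_iUnion.1 (hVc ▸ mem_univ z)
  let wf := (IsWellFounded.wf : WellFounded (WellOrderingRel (α := X)))
  refine ⟨fun z => wf.min {b | z ∈ V b} (hne z), fun z => hVs _ (wf.min_mem _ (hne z)), ?_, ?_⟩
  · intro b
    -- A fibre is an open set minus the union of the earlier open sets, hence Borel even when there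
    -- are uncountably many of them.
    have : {z | wf.min {b | z ∈ V b} (hne z) = b} = V b \ ⋃ b' ∈ {b' | WellOrderingRel b' b}, V b' := by
      ext z
      simp only [mem_ofPred_eq, Set.mem_sdiff, mem_iUnion, not_exists]
      constructor
      · rintro rfl
        exact ⟨wf.min_mem _ (hne z), fun b' hb' hz => wf.not_lt_min {b | z ∈ V b} hz hb'⟩
      · rintro ⟨h1, h2⟩
        rcases trichotomous_of WellOrderingRel (wf.min {b | z ∈ V b} (hne z)) b with h | h | h
        · exact absurd (wf.min_mem _ (hne z)) (h2 _ h)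
        · exact h
        · exact absurd h (wf.not_lt_min {b | z ∈ V b} h1)
    rw [this]
    borelize X
    exact (hVo b).measurableSet.diff
      (isOpen_biUnion fun b' _ => hVo b').measurableSet
  · intro K hK
    refine (hVf.finite_nonempty_inter_compact hK).subset ?_
    rintro _ ⟨z, hz, rfl⟩
    exact ⟨z, wf.min_mem _ (hne z), hz⟩

variable [Group G] [MulAction G X]

/-- The point `g • z'` where `z'` has coordinates `c z + t • w` in the chart `c` selected
at `z = g⁻¹ • x`; here `q = (g, w)`. -/
def samplePoint (a : X → X) (t : ℝ) (x : X) (q : G × E) : X :=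
  q.1 • (chartAt E (a (q.1⁻¹ • x))).symm
    (chartAt E (a (q.1⁻¹ • x)) (q.1⁻¹ • x) + t • q.2)

/-- The parameters `(g, w)` for which `samplePoint` is meaningful and lies in the preferred chart
at `x`. -/
def sampleDomain (a : X → X) (A : Set X) (t : ℝ) (x : X) : Set (G × E) :=
  {q | a (q.1⁻¹ • x) ∈ A ∧
    chartAt E (a (q.1⁻¹ • x)) (q.1⁻¹ • x) + t • q.2 ∈ (chartAt E (a (q.1⁻¹ • x))).target ∧
    samplePoint a t x q ∈ (chartAt E x).source}

/-- Since `(sg)⁻¹(sx) = g⁻¹x`, the selected chart and the displaced point are unchanged; only the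
final application of the group element differs. This is the source of equivariance. -/
theorem samplePoint_smul (a : X → X) (t : ℝ) (x : X) (s : G) (q : G × E) :
    samplePoint a t (s • x) (s * q.1, q.2) = s • samplePoint a t x q := by
  simp [samplePoint, mul_smul]

variable [TopologicalSpace G] [IsTopologicalGroup G] [ContinuousSMul G X]

omit [IsTopologicalGroup G] in
theorem tendsto_samplePoint {a : X → X} (ha : ∀ z, z ∈ (chartAt E (a z)).source)
    (x : X) (q : G × E) : Tendsto (fun t => samplePoint a t x q) (𝓝 0) (𝓝 x) := by
  set c := chartAt E (a (q.1⁻¹ • x)) with hc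
  have h1 : Tendsto (fun t : ℝ => c (q.1⁻¹ • x) + t • q.2) (𝓝 0) (𝓝 (c (q.1⁻¹ • x))) := by
    have : Continuous fun t : ℝ => c (q.1⁻¹ • x) + t • q.2 := by fun_prop
    simpa using this.tendsto 0
  have h2 := ((c.symm.continuousAt (c.map_source (ha _))).tendsto.comp h1).const_smul q.1
  rw [c.left_inv (ha _), smul_inv_smul] at h2
  exact h2

omit [IsTopologicalGroup G] in
theorem eventually_mem_sampleDomain {a : X → X} (ha : ∀ z, z ∈ (chartAt E (a z)).source)
    {A : Set X} {x : X} {q : G × E} (hA : a (q.1⁻¹ • x) ∈ A) :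
    ∀ᶠ t in 𝓝 0, q ∈ sampleDomain a A t x := by
  set c := chartAt E (a (q.1⁻¹ • x)) with hc
  have h1 : Tendsto (fun t : ℝ => c (q.1⁻¹ • x) + t • q.2) (𝓝 0) (𝓝 (c (q.1⁻¹ • x))) := by
    have : Continuous fun t : ℝ => c (q.1⁻¹ • x) + t • q.2 := by fun_prop
    simpa using this.tendsto 0
  filter_upwards [h1 (c.open_target.mem_nhds (c.map_source (ha _))),
    tendsto_samplePoint ha x q ((chartAt E x).open_source.mem_nhds (mem_chart_source E x))]
    with t h2 h3
  exact ⟨hA, h2, h3⟩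

variable [MeasurableSpace E] [BorelSpace E] [FiniteDimensional ℝ E] [MeasurableSpace G]
  [BorelSpace G]

omit [NormedSpace ℝ E] [FiniteDimensional ℝ E] in
theorem measurableSet_inter_preimage_of_continuousOn {α : Type*} [TopologicalSpace α]
    [MeasurableSpace α] [OpensMeasurableSpace α] {O : Set α} (hO : IsOpen O) {T : α → E}
    (hT : ContinuousOn T O) {S : Set E} (hS : MeasurableSet S) :
    MeasurableSet (O ∩ T ⁻¹' S) := by
  classical
  have h : Measurable (O.piecewise T fun _ => 0) :=
    hT.measurable_piecewise continuousOn_const hO.measurableSet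
  have : O ∩ T ⁻¹' S = O ∩ (O.piecewise T fun _ => 0) ⁻¹' S := by
    ext q
    refine and_congr_right fun hq => ?_
    simp [hq]
  rw [this]
  exact hO.measurableSet.inter (h hS)

/-- For a fixed selected chart, the conditions are open and the sampled point is continuous in `(g,
w)`. Countability of `A` lets the pieces be assembled. -/
theorem measurableSet_sampleDomain_inter {a : X → X} (ha : ∀ z, z ∈ (chartAt E (a z)).source)
    (ham : ∀ b, MeasurableSet[borel X] {z | a z = b}) {A : Set X} (hA : A.Countable) (t : ℝ)
    (x : X) {S : Set E} (hS : MeasurableSet S) :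
    MeasurableSet {q : G × E | q ∈ sampleDomain a A t x ∧
      chartAt E x (samplePoint a t x q) ∈ S} := by
  have hcont : Continuous fun g : G => g⁻¹ • x := continuous_inv.smul continuous_const
  have hm1 : ∀ b, MeasurableSet {g : G | a (g⁻¹ • x) = b} := by
    intro b
    borelize X
    exact hcont.measurable (ham b)
  let f1 : X → G × E → E := fun b q => chartAt E b (q.1⁻¹ • x) + t • q.2
  let f2 : X → G × E → X := fun b q => q.1 • (chartAt E b).symm (f1 b q)
  let U1 : X → Set (G × E) := fun b => (fun q : G × E => q.1⁻¹ • x) ⁻¹' (chartAt E b).source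
  let U2 : X → Set (G × E) := fun b => U1 b ∩ f1 b ⁻¹' (chartAt E b).target
  let U3 : X → Set (G × E) := fun b => U2 b ∩ f2 b ⁻¹' (chartAt E x).source
  have hU1 : ∀ b, IsOpen (U1 b) := fun b =>
    (chartAt E b).open_source.preimage (hcont.comp continuous_fst)
  have hf1 : ∀ b, ContinuousOn (f1 b) (U1 b) := fun b =>
    ((chartAt E b).continuousOn.comp (hcont.comp continuous_fst).continuousOn
      fun q hq => hq).add (continuous_snd.const_smul t).continuousOn
  have hU2 : ∀ b, IsOpen (U2 b) := fun b =>
    (hf1 b).isOpen_inter_preimage (hU1 b) (chartAt E b).open_target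
  have hf2 : ∀ b, ContinuousOn (f2 b) (U2 b) := fun b =>
    continuous_fst.continuousOn.smul ((chartAt E b).continuousOn_symm.comp
      ((hf1 b).mono inter_subset_left) fun q hq => hq.2)
  have hU3 : ∀ b, IsOpen (U3 b) := fun b =>
    (hf2 b).isOpen_inter_preimage (hU2 b) (chartAt E x).open_source
  have hT : ∀ b, ContinuousOn (chartAt E x ∘ f2 b) (U3 b) := fun b =>
    (chartAt E x).continuousOn.comp ((hf2 b).mono inter_subset_left) fun q hq => hq.2
  have : {q : G × E | q ∈ sampleDomain a A t x ∧ chartAt E x (samplePoint a t x q) ∈ S} =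
      ⋃ b ∈ A, ({g : G | a (g⁻¹ • x) = b} ×ˢ univ) ∩
        (U3 b ∩ (chartAt E x ∘ f2 b) ⁻¹' S) := by
    ext q
    simp only [mem_ofPred_eq, mem_iUnion]
    constructor
    · rintro ⟨⟨h1, h2, h3⟩, h4⟩
      exact ⟨_, h1, ⟨rfl, trivial⟩, ⟨⟨ha _, h2⟩, h3⟩, h4⟩
    · rintro ⟨b, hb, ⟨h1, -⟩, ⟨⟨-, h2⟩, h3⟩, h4⟩
      have h1 : a (q.1⁻¹ • x) = b := h1
      subst h1
      exact ⟨⟨hb, h2, h3⟩, h4⟩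
  rw [this]
  exact MeasurableSet.biUnion hA fun b _ => ((hm1 b).prod .univ).inter
    (measurableSet_inter_preimage_of_continuousOn (hU3 b) (hT b) hS)

theorem measurableSet_sampleDomain {a : X → X} (ha : ∀ z, z ∈ (chartAt E (a z)).source)
    (ham : ∀ b, MeasurableSet[borel X] {z | a z = b}) {A : Set X} (hA : A.Countable) (t : ℝ)
    (x : X) : MeasurableSet (sampleDomain a A t x : Set (G × E)) := by
  simpa using measurableSet_sampleDomain_inter (G := G) ha ham hA t x (MeasurableSet.univ (α := E))

theorem aemeasurable_samplePoint {a : X → X} (ha : ∀ z, z ∈ (chartAt E (a z)).source)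
    (ham : ∀ b, MeasurableSet[borel X] {z | a z = b}) {A : Set X} (hA : A.Countable) (t : ℝ)
    (x : X) (ρ : Measure (G × E)) :
    AEMeasurable (fun q => chartAt E x (samplePoint a t x q))
      (ρ.restrict (sampleDomain a A t x)) := by
  classical
  have hD := measurableSet_sampleDomain (G := G) ha ham hA t x
  refine ⟨(sampleDomain a A t x).piecewise (fun q => chartAt E x (samplePoint a t x q))
    fun _ => 0, fun S hS => ?_, ?_⟩
  · rw [Set.piecewise_preimage, Set.ite]
    refine .union ?_ ((measurable_const hS).diff hD)
    convert measurableSet_sampleDomain_inter (G := G) ha ham hA t x hS using 1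
    ext q
    exact and_comm
  · filter_upwards [ae_restrict_mem hD] with q hq
    simp [hq]

/-- By Fubini it suffices to fix `g`. Then `w` passes through a dilation by `t ≠ 0`, a translation
and a chart expression of `g`, and preimages of null sets under each of these are null. -/
theorem map_samplePoint_absolutelyContinuous {μ : Measure E} [μ.IsAddHaarMeasure]
    (hd : ∀ (g : G) (c c' : OpenPartialHomeomorph X E), c ∈ atlas E X → c' ∈ atlas E X →
      DifferentiableOn ℝ (chartAction g c c') (chartAction g c c').source)
    {a : X → X} (ha : ∀ z, z ∈ (chartAt E (a z)).source)
    (ham : ∀ b, MeasurableSet[borel X] {z | a z = b}) {A : Set X} (hA : A.Countable) {t : ℝ}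
    (ht : t ≠ 0) (x : X) (m : Measure G) [SFinite m] {u : Measure E} [SFinite u] (hu : u ≪ μ) :
    ((m.prod u).restrict (sampleDomain a A t x)).map
      (fun q => chartAt E x (samplePoint a t x q)) ≪ μ := by
  refine Measure.AbsolutelyContinuous.mk fun N hN hN0 => ?_
  have hD := measurableSet_sampleDomain (G := G) ha ham hA t x
  rw [Measure.map_apply_of_aemeasurable (aemeasurable_samplePoint ha ham hA t x _) hN,
    Measure.restrict_apply' hD]
  have hms := measurableSet_sampleDomain_inter (G := G) ha ham hA t x hN
  have hset : (fun q : G × E => chartAt E x (samplePoint a t x q)) ⁻¹' N ∩ sampleDomain a A t x =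
      {q : G × E | q ∈ sampleDomain a A t x ∧ chartAt E x (samplePoint a t x q) ∈ N} := by
    ext q
    exact and_comm
  rw [hset, Measure.measure_prod_null hms]
  refine .of_forall fun g => hu ?_
  set c := chartAt E (a (g⁻¹ • x)) with hc
  set ψ := chartAction g c (chartAt E x)
  have h1 : μ (ψ.source ∩ ψ ⁻¹' N) = 0 := by
    refine measure_source_inter_preimage_eq_zero ψ ?_ hN0
    rw [chartAction_target]
    exact hd g⁻¹ _ _ (chart_mem_atlas E x) (chart_mem_atlas E _)
  have h2 : μ ((fun w => c (g⁻¹ • x) + t • w) ⁻¹' (ψ.source ∩ ψ ⁻¹' N)) = 0 := by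
    have : (fun w => c (g⁻¹ • x) + t • w) ⁻¹' (ψ.source ∩ ψ ⁻¹' N) =
        (t • ·) ⁻¹' ((c (g⁻¹ • x) + ·) ⁻¹' (ψ.source ∩ ψ ⁻¹' N)) := rfl
    rw [this, Measure.addHaar_preimage_smul μ ht, measure_preimage_add, h1, mul_zero]
  refine measure_mono_null ?_ h2
  rintro w ⟨⟨-, h3, h4⟩, h5⟩
  exact ⟨⟨h3, h4⟩, h5⟩

omit [FiniteDimensional ℝ E] [NormedSpace ℝ E] [NormedAddCommGroup E] [ChartedSpace E X]
  [MeasurableSpace E] [BorelSpace E] in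
-- An integrable density lives, up to a null set, on a σ-compact subset of `G`: exhaust the sets
-- `{1/(k+1) ≤ b}`, of finite measure, by compact sets. Each compact set meets finitely many
-- selected charts.
theorem exists_countable_ae_mem [LocallyCompactSpace G] {a : X → X}
    (hac : ∀ K : Set X, IsCompact K → (a '' K).Finite) (x : X) {b : G → ℝ}
    (hb : Continuous b) (hbi : Integrable b Measure.haar) :
    ∃ A : Set X, A.Countable ∧
      ∀ᵐ g ∂(Measure.haar.withDensity fun g => ENNReal.ofReal (b g)), a (g⁻¹ • x) ∈ A := by
  have hcont : Continuous fun g : G => g⁻¹ • x := continuous_inv.smul continuous_const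
  let S : ℕ → Set G := fun k => {g | (1 / (k + 1 : ℝ)) ≤ b g}
  have hSm : ∀ k, MeasurableSet (S k) := fun k => (isClosed_le continuous_const hb).measurableSet
  have hSf : ∀ k, Measure.haar (S k) ≠ ⊤ := fun k =>
    (hbi.measure_ge_lt_top (ε := 1 / (k + 1 : ℝ)) (by positivity)).ne
  have hK : ∀ k l : ℕ, ∃ K ⊆ S k, IsCompact K ∧ IsClosed K ∧
      Measure.haar (S k \ K) < ENNReal.ofReal (1 / (l + 1 : ℝ)) := by
    intro k l
    exact (hSm k).exists_isCompact_isClosed_sdiff_lt (hSf k) (by simp; positivity)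
  choose K hKS hKc _ hKl using hK
  refine ⟨⋃ k, ⋃ l, a '' ((fun g : G => g⁻¹ • x) '' K k l), countable_iUnion fun k =>
    countable_iUnion fun l => (hac _ ((hKc k l).image hcont)).countable, ?_⟩
  have hnull : ∀ k, Measure.haar (S k \ ⋃ l, K k l) = 0 := by
    intro k
    have hlim : Tendsto (fun l : ℕ => ENNReal.ofReal (1 / (l + 1 : ℝ))) atTop (𝓝 0) := by
      have := ENNReal.tendsto_ofReal (tendsto_one_div_add_atTop_nhds_zero_nat (𝕜 := ℝ))
      simpa using this
    refine le_antisymm (ge_of_tendsto' hlim fun l => ?_) zero_le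
    exact (measure_mono (sdiff_subset_sdiff_right (subset_iUnion _ l))).trans (hKl k l).le
  have hall : ∀ᵐ g ∂(Measure.haar : Measure G), ∀ k, g ∉ S k \ ⋃ l, K k l :=
    ae_all_iff.2 fun k => measure_eq_zero_iff_ae_notMem.1 (hnull k)
  rw [ae_withDensity_iff hb.measurable.ennreal_ofReal]
  filter_upwards [hall] with g hg hbg
  have hpos : 0 < b g := by
    by_contra h
    exact hbg (ENNReal.ofReal_eq_zero.2 (not_lt.1 h))
  obtain ⟨k, hk⟩ := exists_nat_one_div_lt hpos
  have : g ∈ ⋃ l, K k l := by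
    by_contra h
    exact hg k ⟨hk.le, h⟩
  obtain ⟨l, hl⟩ := mem_iUnion.1 this
  exact mem_iUnion.2 ⟨k, mem_iUnion.2 ⟨l, _, ⟨g, hl, rfl⟩, rfl⟩⟩

end Sampling
-- Measurability and null sets in product charts
section PowerCharts

variable {𝕜 : Type*} [RCLike 𝕜] {n p : ℕ} {X : Type*} [TopologicalSpace X]
  [ChartedSpace (EuclideanSpace ℝ (Fin n)) X]

theorem isLebesgueMeasurable_pow_iff {f : (Fin p → X) → 𝕜} :
    IsLebesgueMeasurable (ModelPow n p) f ↔
      ∀ c : Fin p → OpenPartialHomeomorph X (EuclideanSpace ℝ (Fin n)),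
        (∀ j, c j ∈ atlas (EuclideanSpace ℝ (Fin n)) X) →
        AEMeasurable (fun v : Fin p → EuclideanSpace ℝ (Fin n) => f fun j => (c j).symm (v j))
          (volume.restrict (univ.pi fun j => (c j).target)) := by
  constructor
  · intro h c hc
    exact h (OpenPartialHomeomorph.pi c) ⟨c, fun i _ => hc i, rfl⟩
  · rintro h _ ⟨c, hc, rfl⟩
    exact h c fun j => hc j trivial

theorem isNegligible_pow_iff {N : Set (Fin p → X)} :
    IsNegligible (ModelPow n p) N ↔
      ∀ c : Fin p → OpenPartialHomeomorph X (EuclideanSpace ℝ (Fin n)),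
        (∀ j, c j ∈ atlas (EuclideanSpace ℝ (Fin n)) X) →
        volume {v : Fin p → EuclideanSpace ℝ (Fin n) | (∀ j, v j ∈ (c j).target) ∧
          (fun j => (c j).symm (v j)) ∈ N} = 0 := by
  have key : ∀ c : Fin p → OpenPartialHomeomorph X (EuclideanSpace ℝ (Fin n)),
      {v : Fin p → EuclideanSpace ℝ (Fin n) | (∀ j, v j ∈ (c j).target) ∧
          (fun j => (c j).symm (v j)) ∈ N} =
        (univ.pi fun j => (c j).target) ∩ (fun v j => (c j).symm (v j)) ⁻¹' N := by
    intro c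
    ext v
    simp [Set.mem_pi]
  constructor
  · intro h c hc
    rw [key]
    exact h (OpenPartialHomeomorph.pi c) ⟨c, fun i _ => hc i, rfl⟩
  · rintro h _ ⟨c, hc, rfl⟩
    have := h c fun j => hc j trivial
    rw [key] at this
    exact this

end PowerCharts

/-! ### The uniform law on the unit ball -/

section UniformBall

/-- The uniform probability measure on the unit ball of a space. -/
noncomputable abbrev unitBallMeasure (E : Type*) [SeminormedAddCommGroup E] [MeasureSpace E] : Measure E :=
  ProbabilityTheory.cond volume (Metric.closedBall 0 1)

instance isProbabilityMeasure_unitBallMeasure (E : Type*) [SeminormedAddCommGroup E] [MeasureSpace E]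
    [ProperSpace E] [(volume : Measure E).IsOpenPosMeasure]
    [IsFiniteMeasureOnCompacts (volume : Measure E)] :
    IsProbabilityMeasure (unitBallMeasure E) :=
  ProbabilityTheory.cond_isProbabilityMeasure_of_finite
    (Metric.measure_closedBall_pos volume 0 one_pos).ne' measure_closedBall_lt_top.ne

/-- In the sup norm the unit ball of a power is the power of the unit ball, so independent
displacements give genuine ball averages on `(ℝⁿ)^p`. -/
theorem pi_unitBallMeasure (n p : ℕ) :
    Measure.pi (fun _ : Fin p => unitBallMeasure (EuclideanSpace ℝ (Fin n))) =
      unitBallMeasure (Fin p → EuclideanSpace ℝ (Fin n)) := by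
  refine Measure.pi_eq fun s hs => ?_
  have hB : Metric.closedBall (0 : Fin p → EuclideanSpace ℝ (Fin n)) 1 =
      univ.pi fun _ => Metric.closedBall 0 1 := by
    rw [closedBall_pi _ zero_le_one]; rfl
  rw [unitBallMeasure, hB, ProbabilityTheory.cond_apply
    (MeasurableSet.univ_pi fun _ => Metric.isClosed_closedBall.measurableSet), ← Set.pi_inter_distrib,
    volume_pi_pi, volume_pi_pi]
  simp only [ProbabilityTheory.cond_apply Metric.isClosed_closedBall.measurableSet]
  rw [Finset.prod_mul_distrib, ENNReal.prod_inv_distrib]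
  intro i _ j _ _
  exact Or.inr measure_closedBall_lt_top.ne

instance (n p : ℕ) :
    IsProbabilityMeasure (unitBallMeasure (Fin p → EuclideanSpace ℝ (Fin n))) := by
  rw [← pi_unitBallMeasure]
  infer_instance

theorem integral_unitBallMeasure {E : Type*} [NormedAddCommGroup E] [MeasureSpace E]
    (h : E → ℝ) :
    ∫ w, h w ∂unitBallMeasure E = ⨍ w in Metric.closedBall 0 1, h w := by
  rw [unitBallMeasure, ProbabilityTheory.cond, setAverage_eq']

end UniformBall

/-- Data for approximating the values at `x` of functions on `X` by averages: a choice of charts,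
and a family of probability measures on `G` indexed by the points of `X`. -/
structure SamplingFamily (n : ℕ) (G X : Type*) [TopologicalSpace X]
    [ChartedSpace (EuclideanSpace ℝ (Fin n)) X] [Group G] [MulAction G X] [MeasurableSpace G] where
  /-- The chart selected at a point. -/
  sel : X → X
  mem_source : ∀ z, z ∈ (chartAt (EuclideanSpace ℝ (Fin n)) (sel z)).source
  measurableSet_fiber : ∀ b, MeasurableSet[borel X] {z | sel z = b}
  /-- The charts that are relevant for a point. -/
  charts : X → Set X
  countable_charts : ∀ x, (charts x).Countable
  /-- The averaging measures. -/
  meas : X → Measure G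
  isProbabilityMeasure_meas : ∀ x, IsProbabilityMeasure (meas x)
  ae_mem_charts : ∀ x, ∀ᵐ g ∂meas x, sel (g⁻¹ • x) ∈ charts x

attribute [instance] SamplingFamily.isProbabilityMeasure_meas

/-! ### Averages over sampled points -/

namespace SamplingFamily

variable {𝕜 : Type*} [RCLike 𝕜] {n p : ℕ} {G X : Type*} [TopologicalSpace X]
  [ChartedSpace (EuclideanSpace ℝ (Fin n)) X] [Group G] [MulAction G X] [MeasurableSpace G]
  (S : SamplingFamily n G X)

/-- The point sampled by a parameter. -/
noncomputable def point (t : ℝ) (x : X) (q : G × EuclideanSpace ℝ (Fin n)) : X := samplePoint S.sel t x q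

/-- The set of admissible parameters. -/
def domain (t : ℝ) (x : X) : Set (G × EuclideanSpace ℝ (Fin n)) :=
  sampleDomain S.sel (S.charts x) t x

/-- The measure on all parameters. -/
noncomputable def fullLaw (x : X) : Measure (G × EuclideanSpace ℝ (Fin n)) :=
  (S.meas x).prod (unitBallMeasure (EuclideanSpace ℝ (Fin n)))

instance (x : X) : IsProbabilityMeasure (S.fullLaw x) :=
  inferInstanceAs (IsProbabilityMeasure (Measure.prod _ _))

/-- The measure on the admissible parameters. -/
noncomputable def law (t : ℝ) (x : X) : Measure (G × EuclideanSpace ℝ (Fin n)) :=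
  (S.fullLaw x).restrict (S.domain t x)

instance (t : ℝ) (x : X) : IsFiniteMeasure (S.law t x) :=
  inferInstanceAs (IsFiniteMeasure (Measure.restrict _ _))

theorem law_univ_le (t : ℝ) (x : X) : S.law t x univ ≤ 1 := by
  rw [law, Measure.restrict_apply_univ]
  exact prob_le_one

/-- The average of `f` over the points sampled near `x`. -/
noncomputable def avg (t : ℝ) (f : (Fin p → X) → 𝕜) (x : Fin p → X) : 𝕜 :=
  ∫ q, f (fun j => S.point t (x j) (q j)) ∂Measure.pi fun j => S.law t (x j)

theorem norm_avg_le {f : (Fin p → X) → 𝕜} {C : ℝ} (hC : ∀ x, ‖f x‖ ≤ C) (t : ℝ)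
    (x : Fin p → X) : ‖S.avg t f x‖ ≤ C := by
  have hC0 : 0 ≤ C := (norm_nonneg _).trans (hC x)
  refine (norm_integral_le_of_norm_le_const (.of_forall fun q => hC _)).trans ?_
  refine mul_le_of_le_one_right hC0 ?_
  rw [Measure.real, Measure.pi_univ]
  exact ENNReal.toReal_le_of_le_ofReal zero_le_one
    (by simpa using Finset.prod_le_one' fun i _ => S.law_univ_le t (x i))

variable [TopologicalSpace G] [IsTopologicalGroup G] [ContinuousSMul G X] [BorelSpace G]

theorem measurableSet_domain (t : ℝ) (x : X) : MeasurableSet (S.domain t x) :=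
  measurableSet_sampleDomain S.mem_source S.measurableSet_fiber (S.countable_charts x) t x

theorem ae_mem_domain (t : ℝ) (x : Fin p → X) :
    ∀ᵐ q ∂Measure.pi fun j => S.law t (x j), ∀ j, q j ∈ S.domain t (x j) := by
  refine eventually_all.2 fun j => ?_
  exact Measure.tendsto_eval_ae_ae.eventually
    (ae_restrict_mem (μ := S.fullLaw (x j)) (S.measurableSet_domain t (x j)))

omit [IsTopologicalGroup G] [BorelSpace G] in
theorem eventually_ae_mem_domain (x : X) :
    ∀ᵐ q ∂S.fullLaw x, ∀ᶠ t in 𝓝 0, q ∈ S.domain t x := by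
  have : ∀ᵐ q ∂S.fullLaw x, S.sel (q.1⁻¹ • x) ∈ S.charts x :=
    Measure.quasiMeasurePreserving_fst.ae (S.ae_mem_charts x)
  filter_upwards [this] with q hq
  exact eventually_mem_sampleDomain S.mem_source hq

/-- Almost every fixed parameter is admissible for all small `t`, so restricting to admissible
parameters loses no mass in the limit. -/
theorem tendsto_law_univ (x : X) : Tendsto (fun t => S.law t x univ) (𝓝[>] 0) (𝓝 1) := by
  have := tendsto_measure_of_ae_tendsto_indicator_of_isFiniteMeasure (𝓝[>] (0 : ℝ))
    (A := univ) (μ := S.fullLaw x) MeasurableSet.univ (fun t => S.measurableSet_domain t x) ?_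
  · simpa [law] using this
  · filter_upwards [S.eventually_ae_mem_domain x] with q hq
    filter_upwards [hq.filter_mono nhdsWithin_le_nhds] with t ht
    simp [ht]

variable [IsManifold (𝓡 n) 1 X]

theorem map_law_absolutelyContinuous (h : IsC1Action n G X) {t : ℝ} (ht : t ≠ 0)
    (x : Fin p → X) :
    (Measure.pi fun j => S.law t (x j)).map
      (fun q j => chartAt (EuclideanSpace ℝ (Fin n)) (x j) (S.point t (x j) (q j))) ≪
      (volume : Measure (Fin p → EuclideanSpace ℝ (Fin n))) := by
  have hae := fun j => aemeasurable_samplePoint S.mem_source S.measurableSet_fiber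
    (S.countable_charts (x j)) t (x j) (S.fullLaw (x j))
  have hfin : ∀ j, IsFiniteMeasure ((S.law t (x j)).map
      (fun q => chartAt (EuclideanSpace ℝ (Fin n)) (x j) (S.point t (x j) q))) :=
    fun j => inferInstance
  have h1 := Measure.pi_map_pi (μ := fun j => S.law t (x j))
    (f := fun j q => chartAt (EuclideanSpace ℝ (Fin n)) (x j) (S.point t (x j) q))
    (hμ := fun j => inferInstance) hae
  rw [h1]
  exact pi_absolutelyContinuous fun j => map_samplePoint_absolutelyContinuous
    (fun g c c' hc hc' => h.differentiableOn_chartAction G g hc hc') S.mem_source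
    S.measurableSet_fiber (S.countable_charts (x j)) ht (x j) _
    (ProbabilityTheory.cond_absolutelyContinuous)

omit [IsManifold (𝓡 n) 1 X] in
theorem aemeasurable_chart_point (t : ℝ) (x : Fin p → X) :
    AEMeasurable (fun q j => chartAt (EuclideanSpace ℝ (Fin n)) (x j) (S.point t (x j) (q j)))
      (Measure.pi fun j => S.law t (x j)) :=
  aemeasurable_pi_lambda _ fun j => (aemeasurable_samplePoint S.mem_source S.measurableSet_fiber
    (S.countable_charts (x j)) t (x j) (S.fullLaw (x j))).comp_quasiMeasurePreserving
    (Measure.quasiMeasurePreserving_eval _ j)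

theorem ae_notMem_of_isNegligible (h : IsC1Action n G X) {t : ℝ} (ht : t ≠ 0)
    (x : Fin p → X) {N : Set (Fin p → X)} (hN : IsNegligible (ModelPow n p) N) :
    ∀ᵐ q ∂Measure.pi fun j => S.law t (x j), (fun j => S.point t (x j) (q j)) ∉ N := by
  have h0 := isNegligible_pow_iff.1 hN (fun j => chartAt _ (x j)) fun j => chart_mem_atlas _ _
  have h1 := (S.map_law_absolutelyContinuous h ht x).ae_le (measure_eq_zero_iff_ae_notMem.1 h0)
  filter_upwards [ae_of_ae_map (S.aemeasurable_chart_point t x) h1, S.ae_mem_domain t x]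
    with q hq hD hqN
  refine hq ⟨fun j => OpenPartialHomeomorph.map_source _ (hD j).2.2, ?_⟩
  convert hqN using 2 with j
  exact OpenPartialHomeomorph.left_inv _ (hD j).2.2

/-- As `f` is only Lebesgue measurable, composing with the sampled point requires its law in the
chart at `x` to be absolutely continuous. -/
theorem aestronglyMeasurable_point (h : IsC1Action n G X) {t : ℝ} (ht : t ≠ 0)
    (x : Fin p → X) {f : (Fin p → X) → 𝕜} (hf : IsLebesgueMeasurable (ModelPow n p) f) :
    AEStronglyMeasurable (fun q => f fun j => S.point t (x j) (q j))
      (Measure.pi fun j => S.law t (x j)) := by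
  have h0 := isLebesgueMeasurable_pow_iff.1 hf (fun j => chartAt _ (x j))
    fun j => chart_mem_atlas _ _
  have h1 := S.map_law_absolutelyContinuous h ht x
  have hT := S.aemeasurable_chart_point t x
  have hopen : IsOpen (univ.pi fun j => (chartAt (EuclideanSpace ℝ (Fin n)) (x j)).target) :=
    isOpen_set_pi finite_univ fun j _ => OpenPartialHomeomorph.open_target _
  have h2 : (Measure.pi fun j => S.law t (x j)).map
      (fun q j => chartAt (EuclideanSpace ℝ (Fin n)) (x j) (S.point t (x j) (q j))) ≪
      volume.restrict (univ.pi fun j => (chartAt (EuclideanSpace ℝ (Fin n)) (x j)).target) := by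
    refine Measure.AbsolutelyContinuous.mk fun N hN hN0 => ?_
    rw [Measure.restrict_apply hN] at hN0
    have h3 := ae_of_ae_map hT (h1.ae_le (measure_eq_zero_iff_ae_notMem.1 hN0))
    rw [Measure.map_apply_of_aemeasurable hT hN, measure_eq_zero_iff_ae_notMem]
    filter_upwards [h3, S.ae_mem_domain t x] with q hq hD hqN
    exact hq ⟨hqN, fun j _ => OpenPartialHomeomorph.map_source _ (hD j).2.2⟩
  refine (((h0.mono_ac h2).comp_aemeasurable hT).congr ?_).aestronglyMeasurable
  filter_upwards [S.ae_mem_domain t x] with q hD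
  simp only [Function.comp_apply]
  congr 1
  ext j
  exact OpenPartialHomeomorph.left_inv _ (hD j).2.2

theorem integrable_point (h : IsC1Action n G X) {t : ℝ} (ht : t ≠ 0)
    (x : Fin p → X) (f : CurlyLInftyPow 𝕜 n X p) :
    Integrable (fun q => f.1 fun j => S.point t (x j) (q j))
      (Measure.pi fun j => S.law t (x j)) := by
  obtain ⟨hf, C, hC⟩ := f.2
  exact .of_bound (S.aestronglyMeasurable_point h ht x hf) C (.of_forall fun q => hC _)

omit [IsManifold (𝓡 n) 1 X] in
-- Moves the dependence on `t` from the measure to the integrand, so that dominated convergence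
-- applies against a fixed probability measure.
theorem avg_eq_integral_indicator (t : ℝ) (f : (Fin p → X) → 𝕜) (x : Fin p → X) :
    S.avg t f x = ∫ q, (univ.pi fun j => S.domain t (x j)).indicator
      (fun q => f fun j => S.point t (x j) (q j)) q ∂Measure.pi fun j => S.fullLaw (x j) := by
  rw [integral_indicator (.univ_pi fun j => S.measurableSet_domain t (x j)),
    Measure.restrict_pi_pi]
  rfl

theorem aestronglyMeasurable_indicator_point (h : IsC1Action n G X) {t : ℝ} (ht : t ≠ 0)
    (x : Fin p → X) {f : (Fin p → X) → 𝕜} (hf : IsLebesgueMeasurable (ModelPow n p) f) :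
    AEStronglyMeasurable ((univ.pi fun j => S.domain t (x j)).indicator
      (fun q => f fun j => S.point t (x j) (q j))) (Measure.pi fun j => S.fullLaw (x j)) := by
  rw [aestronglyMeasurable_indicator_iff (.univ_pi fun j => S.measurableSet_domain t (x j)),
    Measure.restrict_pi_pi]
  exact S.aestronglyMeasurable_point h ht x hf

theorem tendsto_avg_of_continuous (h : IsC1Action n G X) (f : CurlyLInftyPow 𝕜 n X p)
    (hfc : Continuous f.1) (x : Fin p → X) :
    Tendsto (fun t => S.avg t f.1 x) (𝓝[>] 0) (𝓝 (f.1 x)) := by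
  obtain ⟨hf, C, hC⟩ := f.2
  have hC0 : 0 ≤ C := (norm_nonneg _).trans (hC x)
  simp_rw [avg_eq_integral_indicator]
  have hconst : f.1 x = ∫ q, f.1 x ∂Measure.pi fun j => S.fullLaw (x j) := by simp
  rw [hconst]
  refine tendsto_integral_filter_of_dominated_convergence (fun _ => C) ?_ ?_
    (integrable_const C) ?_
  · filter_upwards [self_mem_nhdsWithin] with t ht
    exact S.aestronglyMeasurable_indicator_point h (ne_of_gt ht) x hf
  · exact .of_forall fun t => .of_forall fun q => (norm_indicator_le_norm_self _ _).trans (hC _)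
  · have : ∀ᵐ q ∂Measure.pi fun j => S.fullLaw (x j), ∀ j, ∀ᶠ t in 𝓝 0,
        q j ∈ S.domain t (x j) := eventually_all.2 fun j =>
      (Measure.tendsto_eval_ae_ae (μ := fun j => S.fullLaw (x j)) (i := j)).eventually
        (S.eventually_ae_mem_domain (x j))
    filter_upwards [this] with q hq
    have h1 : Tendsto (fun t => f.1 fun j => S.point t (x j) (q j)) (𝓝[>] 0) (𝓝 (f.1 x)) :=
      (hfc.tendsto x).comp ((tendsto_pi_nhds.2 fun j =>
        tendsto_samplePoint S.mem_source (x j) (q j)).mono_left nhdsWithin_le_nhds)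
    refine h1.congr' ?_
    filter_upwards [(eventually_all.2 hq).filter_mono nhdsWithin_le_nhds] with t ht
    rw [indicator_of_mem]
    exact fun j _ => ht j

end SamplingFamily
end EquivLifting

/-! ### Convergence of the averages at Lebesgue points -/

namespace EquivLifting
namespace SamplingFamily

variable {𝕜 : Type*} [RCLike 𝕜] {n p : ℕ} {G X : Type*} [TopologicalSpace X]
  [ChartedSpace (EuclideanSpace ℝ (Fin n)) X] [Group G] [MulAction G X] [MeasurableSpace G]
  (S : SamplingFamily n G X)
variable [TopologicalSpace G] [IsTopologicalGroup G] [ContinuousSMul G X] [BorelSpace G]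
variable [IsManifold (𝓡 n) 1 X]

/-- The integrand of the averages, as a function of the group elements and the displacements. -/
noncomputable def integrand (t : ℝ) (f : (Fin p → X) → 𝕜) (x : Fin p → X)
    (r : (Fin p → G) × (Fin p → EuclideanSpace ℝ (Fin n))) : 𝕜 :=
  (univ.pi fun j => S.domain t (x j)).indicator (fun q => f fun j => S.point t (x j) (q j))
    fun j => (r.1 j, r.2 j)

omit [TopologicalSpace G] [IsTopologicalGroup G] [ContinuousSMul G X] [BorelSpace G]
  [IsManifold (𝓡 n) 1 X] in
theorem norm_integrand_le {f : (Fin p → X) → 𝕜} {C : ℝ} (hC : ∀ x, ‖f x‖ ≤ C) (t : ℝ)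
    (x : Fin p → X) (r : (Fin p → G) × (Fin p → EuclideanSpace ℝ (Fin n))) :
    ‖S.integrand t f x r‖ ≤ C :=
  (norm_indicator_le_norm_self _ _).trans (hC _)

theorem aestronglyMeasurable_integrand (h : IsC1Action n G X) {t : ℝ} (ht : t ≠ 0)
    (x : Fin p → X) {f : (Fin p → X) → 𝕜} (hf : IsLebesgueMeasurable (ModelPow n p) f) :
    AEStronglyMeasurable (S.integrand t f x) ((Measure.pi fun j => S.meas (x j)).prod
      (unitBallMeasure (Fin p → EuclideanSpace ℝ (Fin n)))) := by
  have hmp := measurePreserving_arrowProdEquivProdArrow G (EuclideanSpace ℝ (Fin n)) (Fin p)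
    (fun j => S.meas (x j)) fun _ => unitBallMeasure (EuclideanSpace ℝ (Fin n))
  rw [pi_unitBallMeasure] at hmp
  exact (S.aestronglyMeasurable_indicator_point h ht x hf).comp_measurePreserving hmp.symm

theorem avg_eq_integral_integral (h : IsC1Action n G X) {t : ℝ} (ht : t ≠ 0)
    (x : Fin p → X) (f : CurlyLInftyPow 𝕜 n X p) :
    S.avg t f.1 x = ∫ g, ∫ w, S.integrand t f.1 x (g, w)
      ∂unitBallMeasure (Fin p → EuclideanSpace ℝ (Fin n)) ∂Measure.pi fun j => S.meas (x j) := by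
  obtain ⟨hf, C, hC⟩ := f.2
  have hmp := measurePreserving_arrowProdEquivProdArrow G (EuclideanSpace ℝ (Fin n)) (Fin p)
    (fun j => S.meas (x j)) fun _ => unitBallMeasure (EuclideanSpace ℝ (Fin n))
  rw [pi_unitBallMeasure] at hmp
  rw [avg_eq_integral_indicator, ← integral_prod _ (.of_bound
    (S.aestronglyMeasurable_integrand h ht x hf) C (.of_forall (S.norm_integrand_le hC t x))),
    ← hmp.integral_comp']
  rfl

omit [IsTopologicalGroup G] [BorelSpace G] in
-- With `g` frozen, the mean over `w` is the mean over the ball of radius `t` around `α`, the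
-- coordinates of `g⁻¹x` in the selected charts, of `f` in the charts `c` composed with the action
-- `ψ`. Since `ψ α = v` is a Lebesgue point, `α` is one for the composite.
theorem tendsto_integral_integrand (h : IsC1Action n G X) (f : CurlyLInftyPow 𝕜 n X p)
    {c : Fin p → OpenPartialHomeomorph X (EuclideanSpace ℝ (Fin n))}
    (hc : ∀ j, c j ∈ atlas (EuclideanSpace ℝ (Fin n)) X)
    {v : Fin p → EuclideanSpace ℝ (Fin n)} (hv : ∀ j, v j ∈ (c j).target)
    (hL : Tendsto (fun r => ⨍ y in Metric.closedBall v r,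
      ‖(univ.pi fun j => (c j).target).indicator (fun v => f.1 fun j => (c j).symm (v j)) y -
        f.1 fun j => (c j).symm (v j)‖) (𝓝[>] 0) (𝓝 0)) (g : Fin p → G)
    (hg : ∀ j, S.sel ((g j)⁻¹ • (c j).symm (v j)) ∈ S.charts ((c j).symm (v j))) :
    Tendsto (fun t => ∫ w, S.integrand t f.1 (fun j => (c j).symm (v j)) (g, w)
      ∂unitBallMeasure (Fin p → EuclideanSpace ℝ (Fin n))) (𝓝[>] 0)
      (𝓝 (f.1 fun j => (c j).symm (v j))) := by
  obtain ⟨hf, C, hC⟩ := f.2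
  set x : Fin p → X := fun j => (c j).symm (v j) with hx
  set ft := (univ.pi fun j => (c j).target).indicator (fun v => f.1 fun j => (c j).symm (v j))
    with hft
  have hopen : IsOpen (univ.pi fun j => (c j).target) :=
    isOpen_set_pi finite_univ fun j _ => (c j).open_target
  have hftm : AEStronglyMeasurable ft volume :=
    ((aemeasurable_indicator_iff hopen.measurableSet).2
      (isLebesgueMeasurable_pow_iff.1 hf c hc)).aestronglyMeasurable
  have hftC : ∀ y, ‖ft y‖ ≤ C := fun y => (norm_indicator_le_norm_self _ _).trans (hC _)
  let d : Fin p → OpenPartialHomeomorph X (EuclideanSpace ℝ (Fin n)) :=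
    fun j => chartAt _ (S.sel ((g j)⁻¹ • x j))
  have hd : ∀ j, d j ∈ atlas (EuclideanSpace ℝ (Fin n)) X := fun j => chart_mem_atlas _ _
  let α : Fin p → EuclideanSpace ℝ (Fin n) := fun j => d j ((g j)⁻¹ • x j)
  let τ := fun j => chartAction (g j) (d j) (c j)
  -- Admissibility refers to the preferred chart at `x j`, which may differ from `c j`; `τ'` serves
  -- only to verify it.
  let τ' := fun j => chartAction (g j) (d j) (chartAt (EuclideanSpace ℝ (Fin n)) (x j))
  let ψ := OpenPartialHomeomorph.pi τ
  let ψ' := OpenPartialHomeomorph.pi τ'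
  have hdα : ∀ j, (d j).symm (α j) = (g j)⁻¹ • x j := fun j =>
    (d j).left_inv (S.mem_source _)
  have hτ : ∀ j, α j ∈ (τ j).source := by
    intro j
    rw [mem_chartAction_source, hdα, smul_inv_smul]
    exact ⟨(d j).map_source (S.mem_source _), (c j).map_target (hv j)⟩
  have hτ' : ∀ j, α j ∈ (τ' j).source := by
    intro j
    rw [mem_chartAction_source, hdα, smul_inv_smul]
    exact ⟨(d j).map_source (S.mem_source _), mem_chart_source _ _⟩
  have hτα : ∀ j, τ j (α j) = v j := by
    intro j
    change c j (g j • (d j).symm (α j)) = _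
    rw [hdα, smul_inv_smul]
    exact (c j).right_inv (hv j)
  have hψα : ψ α = v := funext hτα
  have hA : HasStrictFDerivAt ψ (ContinuousLinearMap.pi fun j =>
      (fderiv ℝ (τ j) (α j)).comp (ContinuousLinearMap.proj j)) α :=
    hasStrictFDerivAt_pi.2 fun j =>
      (h.hasStrictFDerivAt_chartAction G (g j) (hd j) (hc j) (hτ j)).comp α
        (ContinuousLinearMap.proj (R := ℝ) (φ := fun _ : Fin p => EuclideanSpace ℝ (Fin n))
          j).hasStrictFDerivAt
  have hB : HasStrictFDerivAt ψ.symm (ContinuousLinearMap.pi fun j =>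
      (fderiv ℝ (chartAction (g j)⁻¹ (c j) (d j)) (ψ α j)).comp
        (ContinuousLinearMap.proj j)) (ψ α) := by
    refine hasStrictFDerivAt_pi.2 fun j => ?_
    refine HasStrictFDerivAt.comp (ψ α) (f := fun y : Fin p → EuclideanSpace ℝ (Fin n) => y j)
      (g := chartAction (g j)⁻¹ (c j) (d j))
      (h.hasStrictFDerivAt_chartAction G (g j)⁻¹ (hc j) (hd j) ?_)
      (ContinuousLinearMap.proj (R := ℝ) (φ := fun _ : Fin p => EuclideanSpace ℝ (Fin n))
          j).hasStrictFDerivAt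
    rw [← chartAction_target]
    exact (τ j).map_source (hτ j)
  have hαψ : α ∈ ψ.source := fun j _ => hτ j
  have hαψ' : α ∈ ψ'.source := fun j _ => hτ' j
  have hlim := tendsto_average_comp_of_hasStrictFDerivAt (μ := volume) ψ hαψ hA hB hftm hftC
    (c := f.1 x) (by rw [hψα]; exact hL)
  obtain ⟨ε, hε, hball⟩ := Metric.nhds_basis_closedBall.mem_iff.1
    (inter_mem (ψ.open_source.mem_nhds hαψ) (ψ'.open_source.mem_nhds hαψ'))
  rw [tendsto_iff_norm_sub_tendsto_zero]
  refine tendsto_of_tendsto_of_tendsto_of_le_of_le' tendsto_const_nhds hlim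
    (.of_forall fun t => norm_nonneg _) ?_
  filter_upwards [Ioo_mem_nhdsGT hε] with t ht
  have hmem : ∀ w ∈ Metric.closedBall (0 : Fin p → EuclideanSpace ℝ (Fin n)) 1,
      α + t • w ∈ ψ.source ∧ α + t • w ∈ ψ'.source := by
    intro w hw
    refine hball ?_
    rw [Metric.mem_closedBall, dist_eq_norm, add_sub_cancel_left, norm_smul, Real.norm_of_nonneg
      ht.1.le]
    rw [mem_closedBall_zero_iff] at hw
    calc t * ‖w‖ ≤ t * 1 := by gcongr; exact ht.1.le
      _ ≤ ε := by rw [mul_one]; exact ht.2.le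
  have heq : ∀ w ∈ Metric.closedBall (0 : Fin p → EuclideanSpace ℝ (Fin n)) 1,
      S.integrand t f.1 x (g, w) = ft (ψ (α + t • w)) := by
    intro w hw
    obtain ⟨h1, h2⟩ := hmem w hw
    have h3 : (fun j => (g j, w j)) ∈ univ.pi fun j => S.domain t (x j) :=
      fun j _ => ⟨hg j, (h2 j trivial).1, (h2 j trivial).2⟩
    have h4 : ψ (α + t • w) ∈ univ.pi fun j => (c j).target :=
      fun j _ => (τ j).map_source (h1 j trivial) |>.1
    rw [integrand, indicator_of_mem h3, hft, indicator_of_mem h4]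
    refine congrArg f.1 (funext fun j => ?_)
    exact ((c j).left_inv (h1 j trivial).2).symm
  have hae : ∀ᵐ w ∂unitBallMeasure (Fin p → EuclideanSpace ℝ (Fin n)),
      S.integrand t f.1 x (g, w) = ft (ψ (α + t • w)) := by
    have := ProbabilityTheory.ae_cond_mem (μ := (volume : Measure (Fin p → EuclideanSpace ℝ (Fin n))))
      (s := Metric.closedBall 0 1) Metric.isClosed_closedBall.measurableSet
    filter_upwards [this] with w hw using heq w hw
  have hmeas : AEStronglyMeasurable (fun w => ft (ψ (α + t • w)))
      (unitBallMeasure (Fin p → EuclideanSpace ℝ (Fin n))) := by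
    have hdψ : DifferentiableOn ℝ ψ.symm ψ.target :=
      h.differentiableOn_pi_chartAction_symm G g hd hc
    have hcont : ContinuousOn (fun w => ψ (α + t • w)) (Metric.closedBall 0 1) :=
      ψ.continuousOn.comp (by fun_prop) fun w hw => (hmem w hw).1
    have ham : AEMeasurable (fun w => ψ (α + t • w))
        (volume.restrict (Metric.closedBall (0 : Fin p → EuclideanSpace ℝ (Fin n)) 1)) :=
      hcont.aemeasurable Metric.isClosed_closedBall.measurableSet
    have hac : (volume.restrict (Metric.closedBall (0 : Fin p → EuclideanSpace ℝ (Fin n)) 1)).map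
        (fun w => ψ (α + t • w)) ≪ volume := by
      refine Measure.AbsolutelyContinuous.mk fun N hN hN0 => ?_
      rw [Measure.map_apply_of_aemeasurable ham hN, Measure.restrict_apply'
        Metric.isClosed_closedBall.measurableSet]
      have h1 := measure_source_inter_preimage_eq_zero ψ hdψ hN0
      have h2 : volume ((t • ·) ⁻¹' ((α + ·) ⁻¹' (ψ.source ∩ ψ ⁻¹' N))) = 0 := by
        rw [Measure.addHaar_preimage_smul _ ht.1.ne', measure_preimage_add, h1, mul_zero]
      refine measure_mono_null ?_ h2
      rintro w ⟨hw1, hw2⟩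
      exact ⟨(hmem w hw2).1, hw1⟩
    exact ((hftm.mono_ac hac).comp_aemeasurable ham).mono_ac
      (Measure.smul_absolutelyContinuous)
  calc ‖∫ w, S.integrand t f.1 x (g, w) ∂unitBallMeasure _ - f.1 x‖
      = ‖∫ w, (ft (ψ (α + t • w)) - f.1 x) ∂unitBallMeasure _‖ := by
        rw [integral_congr_ae hae, integral_sub (.of_bound hmeas C (.of_forall fun w => hftC _))
          (integrable_const _), integral_const, probReal_univ, one_smul]
    _ ≤ ∫ w, ‖ft (ψ (α + t • w)) - f.1 x‖ ∂unitBallMeasure _ := norm_integral_le_integral_norm _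
    _ = _ := by
        rw [integral_unitBallMeasure, setAverage_closedBall_eq (μ := volume) α ht.1]

/-- The quantifier over `S` sits inside the null set: the exceptional points are non-Lebesgue points
of `f` in a chart, irrespective of `S`. Hence an uncountable family of `S` is harmless. For a given
`S`, dominated convergence in `g` concludes. -/
theorem isNegligible_not_tendsto_avg (h : IsC1Action n G X) (f : CurlyLInftyPow 𝕜 n X p) :
    IsNegligible (ModelPow n p) {x | ¬ ∀ S : SamplingFamily n G X,
      Tendsto (fun t => S.avg t f.1 x) (𝓝[>] 0) (𝓝 (f.1 x))} := by
  obtain ⟨hf, C, hC⟩ := f.2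
  refine isNegligible_pow_iff.2 fun c hc => ?_
  set ft := (univ.pi fun j => (c j).target).indicator (fun v => f.1 fun j => (c j).symm (v j))
    with hft
  have hopen : IsOpen (univ.pi fun j => (c j).target) :=
    isOpen_set_pi finite_univ fun j _ => (c j).open_target
  have hftm : AEStronglyMeasurable ft volume :=
    ((aemeasurable_indicator_iff hopen.measurableSet).2
      (isLebesgueMeasurable_pow_iff.1 hf c hc)).aestronglyMeasurable
  have hftC : ∀ y, ‖ft y‖ ≤ C := fun y => (norm_indicator_le_norm_self _ _).trans (hC _)
  have hloc : LocallyIntegrable ft volume :=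
    (memLp_top_of_bound hftm C (.of_forall hftC)).locallyIntegrable le_top
  have hae := IsUnifLocDoublingMeasure.ae_tendsto_average_norm_sub volume hloc 1
  refine measure_mono_null ?_ hae
  rintro v ⟨hv, hbad⟩ hgood
  refine hbad fun S => ?_
  have hvm : v ∈ univ.pi fun j => (c j).target := fun j _ => hv j
  have hvf : ft v = f.1 fun j => (c j).symm (v j) := indicator_of_mem hvm _
  -- Differentiation along balls centred at `v` itself.
  have hL := hgood (l := 𝓝[>] (0 : ℝ)) (fun _ => v) id tendsto_id (by
    filter_upwards [self_mem_nhdsWithin] with r hr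
    exact Metric.mem_closedBall_self (by simpa using (le_of_lt hr : (0 : ℝ) ≤ r)))
  rw [hvf] at hL
  set x : Fin p → X := fun j => (c j).symm (v j) with hx
  have hconst : f.1 x = ∫ g, f.1 x ∂Measure.pi fun j => S.meas (x j) := by simp
  have hev : ∀ᶠ t in 𝓝[>] (0 : ℝ), S.avg t f.1 x = ∫ g, ∫ w, S.integrand t f.1 x (g, w)
      ∂unitBallMeasure (Fin p → EuclideanSpace ℝ (Fin n)) ∂Measure.pi fun j => S.meas (x j) := by
    filter_upwards [self_mem_nhdsWithin] with t ht
    exact S.avg_eq_integral_integral h (ne_of_gt ht) x f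
  refine Tendsto.congr' (hev.mono fun _ h => h.symm) ?_
  rw [hconst]
  refine tendsto_integral_filter_of_dominated_convergence (fun _ => C) ?_ ?_
    (integrable_const C) ?_
  · filter_upwards [self_mem_nhdsWithin] with t ht
    exact (S.aestronglyMeasurable_integrand h (ne_of_gt ht) x hf).integral_prod_right'
  · refine .of_forall fun t => .of_forall fun g => ?_
    refine (norm_integral_le_of_norm_le_const
      (.of_forall fun w => S.norm_integrand_le hC t x (g, w))).trans ?_
    rw [probReal_univ, mul_one]
  · have : ∀ᵐ g ∂Measure.pi fun j => S.meas (x j), ∀ j,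
        S.sel ((g j)⁻¹ • x j) ∈ S.charts (x j) := eventually_all.2 fun j =>
      (Measure.tendsto_eval_ae_ae (μ := fun j => S.meas (x j)) (i := j)).eventually
        (S.ae_mem_charts (x j))
    filter_upwards [this] with g hg
    exact S.tendsto_integral_integrand h f hc hv hL g hg

end SamplingFamily
-- Averages under forgetting coordinates and under translation
theorem prod_mono_left {α β : Type*} [MeasurableSpace α] [MeasurableSpace β] {μ ν : Measure α}
    (h : μ ≤ ν) (ρ : Measure β) [SFinite ρ] : μ.prod ρ ≤ ν.prod ρ := by
  refine Measure.le_intro fun s hs _ => ?_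
  rw [Measure.prod_apply hs, Measure.prod_apply hs]
  exact lintegral_mono' h le_rfl

namespace SamplingFamily

variable {𝕜 : Type*} [RCLike 𝕜] {n p : ℕ} {G X : Type*} [TopologicalSpace X]
  [ChartedSpace (EuclideanSpace ℝ (Fin n)) X] [Group G] [MulAction G X] [MeasurableSpace G]
  (S : SamplingFamily n G X)
variable [TopologicalSpace G] [IsTopologicalGroup G] [ContinuousSMul G X] [BorelSpace G]
variable [IsManifold (𝓡 n) 1 X]

theorem avg_comp_embedding {q : ℕ} (h : IsC1Action n G X) {t : ℝ} (ht : t ≠ 0)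
    (σ : Fin p ↪ Fin q) (f : CurlyLInftyPow 𝕜 n X p) (x : Fin q → X) :
    S.avg t (fun y => f.1 fun i => y (σ i)) x =
      (∏ j : {j // j ∉ Set.range σ}, S.law t (x j) univ).toReal •
        S.avg t f.1 fun i => x (σ i) := by
  have hm := S.aestronglyMeasurable_point h ht (fun i => x (σ i)) f.2.1
  have hmap := pi_map_comp_embedding σ fun j => S.law t (x j)
  have hmeas : Measurable fun (v : Fin q → G × EuclideanSpace ℝ (Fin n)) i => v (σ i) :=
    measurable_pi_lambda _ fun i => measurable_pi_apply _
  rw [avg, avg, ← integral_smul_measure, ← hmap, integral_map hmeas.aemeasurable]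
  rw [hmap]
  exact hm.smul_measure _

theorem tendsto_avg_comp_embedding_sub {q : ℕ} (h : IsC1Action n G X)
    (σ : Fin p ↪ Fin q) (f : CurlyLInftyPow 𝕜 n X p) (x : Fin q → X) :
    Tendsto (fun t => S.avg t (fun y => f.1 fun i => y (σ i)) x - S.avg t f.1 fun i => x (σ i))
      (𝓝[>] 0) (𝓝 0) := by
  obtain ⟨hf, C, hC⟩ := f.2
  have h1 : Tendsto (fun t => ∏ j : {j // j ∉ Set.range σ}, (S.law t (x j) univ).toReal) (𝓝[>] 0)
      (𝓝 (∏ _j : {j // j ∉ Set.range σ}, (1 : ENNReal).toReal)) :=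
    tendsto_finsetProd _ fun j _ =>
      (ENNReal.tendsto_toReal ENNReal.one_ne_top).comp (S.tendsto_law_univ (x j))
  have h2 : Tendsto (fun t => |∏ j : {j // j ∉ Set.range σ}, (S.law t (x j) univ).toReal - 1| * C)
      (𝓝[>] 0) (𝓝 0) := by
    simpa using ((h1.sub_const 1).abs.mul_const C)
  refine squeeze_zero_norm' ?_ h2
  filter_upwards [self_mem_nhdsWithin] with t ht
  rw [S.avg_comp_embedding h (ne_of_gt ht), ENNReal.toReal_prod]
  set a := S.avg t f.1 fun i => x (σ i)
  set c := ∏ j : {j // j ∉ Set.range σ}, (S.law t (x j) univ).toReal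
  have : c • a - a = (c - 1) • a := by rw [sub_smul, one_smul]
  rw [this, norm_smul, Real.norm_eq_abs]
  gcongr
  exact S.norm_avg_le hC t _

/-- Left translation of the group element in the space of parameters. -/
def translate (n : ℕ) (s : G) :
    (G × EuclideanSpace ℝ (Fin n)) ≃ᵐ (G × EuclideanSpace ℝ (Fin n)) :=
  (MeasurableEquiv.mulLeft s).prodCongr (MeasurableEquiv.refl _)

omit [ContinuousSMul G X] [IsManifold (𝓡 n) 1 X] in
theorem point_translate (t : ℝ) (s : G) (x : X) (q : G × EuclideanSpace ℝ (Fin n)) :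
    S.point t x (translate n s q) = s • S.point t (s⁻¹ • x) q := by
  have := samplePoint_smul S.sel t (s⁻¹ • x) s q
  rw [smul_inv_smul] at this
  exact this

omit [ContinuousSMul G X] [IsManifold (𝓡 n) 1 X] in
theorem map_translate_fullLaw (s : G) (x : X) :
    (S.fullLaw x).map (translate n s) =
      ((S.meas x).map (s * ·)).prod (unitBallMeasure (EuclideanSpace ℝ (Fin n))) := by
  have := Measure.map_prod_map (S.meas x) (unitBallMeasure (EuclideanSpace ℝ (Fin n)))
    (measurable_const_mul s) measurable_id
  rw [Measure.map_id] at this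
  exact this.symm

omit [IsManifold (𝓡 n) 1 X] in
-- A minorant of both laws has almost all its mass, for small `t`, on parameters admissible at `x`
-- whose translates back are admissible at `s⁻¹ • x`.
theorem tendsto_restrict_inter_univ (s : G) (x : X) {κ : Measure G} (h1 : κ ≤ S.meas x)
    (h2 : κ ≤ (S.meas (s⁻¹ • x)).map (s * ·)) :
    Tendsto (fun t => ((κ.prod (unitBallMeasure (EuclideanSpace ℝ (Fin n)))).restrict
      (S.domain t x ∩ (translate n s).symm ⁻¹' S.domain t (s⁻¹ • x))).real univ) (𝓝[>] 0)
      (𝓝 (κ.real univ)) := by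
  have : IsFiniteMeasure κ := isFiniteMeasure_of_le _ h1
  have hae1 : ∀ᵐ q ∂κ.prod (unitBallMeasure (EuclideanSpace ℝ (Fin n))),
      ∀ᶠ t in 𝓝 0, q ∈ S.domain t x :=
    ae_mono (prod_mono_left h1 _) (S.eventually_ae_mem_domain x)
  have hae2 : ∀ᵐ q ∂κ.prod (unitBallMeasure (EuclideanSpace ℝ (Fin n))),
      ∀ᶠ t in 𝓝 0, (translate n s).symm q ∈ S.domain t (s⁻¹ • x) := by
    refine ae_mono (prod_mono_left h2 _) ?_
    rw [← map_translate_fullLaw]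
    refine (translate n s).measurableEmbedding.ae_map_iff.2 ?_
    simpa using S.eventually_ae_mem_domain (s⁻¹ • x)
  have := tendsto_measure_of_ae_tendsto_indicator_of_isFiniteMeasure (𝓝[>] (0 : ℝ))
    (A := univ) (μ := κ.prod (unitBallMeasure (EuclideanSpace ℝ (Fin n)))) MeasurableSet.univ
    (fun t => (S.measurableSet_domain t x).inter
      ((translate n s).symm.measurable (S.measurableSet_domain t (s⁻¹ • x)))) ?_
  · have h3 := (ENNReal.tendsto_toReal (measure_ne_top _ _)).comp this
    rw [← univ_prod_univ, Measure.prod_prod,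
      measure_univ (μ := unitBallMeasure (EuclideanSpace ℝ (Fin n))), mul_one] at h3
    simpa [Measure.real, Function.comp_def] using h3
  · filter_upwards [hae1, hae2] with q hq1 hq2
    filter_upwards [hq1.filter_mono nhdsWithin_le_nhds, hq2.filter_mono nhdsWithin_le_nhds]
      with t h3 h4
    simp [h3, h4]

/-- Translating the parameters turns the average at `s⁻¹x` into an integral of the same integrand as
the average at `x`, against a translated law. The two laws are then compared through a common
minorant. -/
theorem eventually_norm_avg_sub_le (h : IsC1Action n G X) (s : Fin p → G) (x : Fin p → X)
    {κ : Fin p → Measure G} (h1 : ∀ j, κ j ≤ S.meas (x j))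
    (h2 : ∀ j, κ j ≤ (S.meas ((s j)⁻¹ • x j)).map (s j * ·)) (f f' : CurlyLInftyPow 𝕜 n X p)
    (hff' : ∀ y, f'.1 y = f.1 fun j => (s j)⁻¹ • y j) {C : ℝ} (hC0 : 0 ≤ C)
    (hC : ∀ y, ‖f.1 y‖ ≤ C) {ε : ℝ} (hε : 0 < ε) :
    ∀ᶠ t in 𝓝[>] 0, ‖S.avg t f'.1 x - S.avg t f.1 fun j => (s j)⁻¹ • x j‖ ≤
      2 * C * (1 - ∏ j, (κ j).real univ) + ε := by
  set y : Fin p → X := fun j => (s j)⁻¹ • x j with hy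
  -- The minorant of the restricted laws: `κ j` times the ball measure, kept where both restrictions
  -- hold.
  let κ' : ℝ → Fin p → Measure (G × EuclideanSpace ℝ (Fin n)) := fun t j =>
    ((κ j).prod (unitBallMeasure (EuclideanSpace ℝ (Fin n)))).restrict
      (S.domain t (x j) ∩ (translate n (s j)).symm ⁻¹' S.domain t (y j))
  have hlim : Tendsto (fun t => 2 * C * (1 - ∏ j, (κ' t j).real univ)) (𝓝[>] 0)
      (𝓝 (2 * C * (1 - ∏ j, (κ j).real univ))) :=
    ((tendsto_finsetProd _ fun j _ =>
      S.tendsto_restrict_inter_univ (s j) (x j) (h1 j) (h2 j)).const_sub 1).const_mul _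
  filter_upwards [hlim.eventually_lt_const (lt_add_of_pos_right _ hε), self_mem_nhdsWithin]
    with t ht ht0
  refine le_trans ?_ ht.le
  let Θ := MeasurableEquiv.piCongrRight fun j => translate n (s j)
  have hmp : MeasurePreserving Θ (Measure.pi fun j => S.law t (y j))
      (Measure.pi fun j => (S.law t (y j)).map (translate n (s j))) :=
    measurePreserving_pi _ _ fun j => ⟨(translate n (s j)).measurable, rfl⟩
  have hΘ : ∀ q, (f.1 fun j => S.point t (y j) (q j)) =
      f'.1 fun j => S.point t (x j) (Θ q j) := by
    intro q
    rw [hff']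
    refine congrArg f.1 (funext fun j => ?_)
    change _ = (s j)⁻¹ • S.point t (x j) (translate n (s j) (q j))
    rw [point_translate, inv_smul_smul]
  have hav : S.avg t f.1 y = ∫ q, (f'.1 fun j => S.point t (x j) (q j))
      ∂Measure.pi fun j => (S.law t (y j)).map (translate n (s j)) := by
    rw [← hmp.integral_comp Θ.measurableEmbedding, avg]
    exact integral_congr_ae (.of_forall hΘ)
  have hm1 := S.aestronglyMeasurable_point h (ne_of_gt ht0) x f'.2.1
  have hm2 : AEStronglyMeasurable (fun q => f'.1 fun j => S.point t (x j) (q j))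
      (Measure.pi fun j => (S.law t (y j)).map (translate n (s j))) := by
    rw [← hmp.aestronglyMeasurable_comp_iff Θ.measurableEmbedding]
    exact (S.aestronglyMeasurable_point h (ne_of_gt ht0) y f.2.1).congr (.of_forall hΘ)
  rw [hav, avg]
  refine norm_integral_pi_sub_le (κ := κ' t) (fun j => ?_) (fun j => ?_)
    (fun j => S.law_univ_le t _) (fun j => ?_) hm1 hm2 (fun q => ?_) hC0
  · exact Measure.restrict_mono inter_subset_left (prod_mono_left (h1 j) _)
  · have : (S.law t (y j)).map (translate n (s j)) = ((S.fullLaw (y j)).map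
        (translate n (s j))).restrict ((translate n (s j)).symm ⁻¹' S.domain t (y j)) := by
      rw [MeasurableEquiv.restrict_map, ← preimage_comp]
      simp [law]
    rw [this, map_translate_fullLaw]
    exact Measure.restrict_mono inter_subset_right (prod_mono_left (h2 j) _)
  · rw [MeasurableEquiv.map_apply]
    exact S.law_univ_le t _
  · rw [hff']
    exact hC _

end SamplingFamily

/-! ### Common minorants from amenability -/

section Amenability

variable {G : Type*} [TopologicalSpace G] [Group G] [IsTopologicalGroup G]
  [LocallyCompactSpace G] [MeasurableSpace G] [BorelSpace G]

theorem map_mul_left_withDensity (k : G → ENNReal) (s : G) :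
    ((Measure.haar : Measure G).withDensity k).map (s * ·) =
      Measure.haar.withDensity fun g => k (s⁻¹ * g) := by
  ext A hA
  have hA' : MeasurableSet ((s * ·) ⁻¹' A) := measurable_const_mul s hA
  rw [Measure.map_apply (measurable_const_mul s) hA, withDensity_apply _ hA',
    withDensity_apply _ hA, ← lintegral_indicator hA, ← lintegral_indicator hA',

    ← lintegral_mul_left_eq_self (A.indicator fun g => k (s⁻¹ * g)) s]
  refine lintegral_congr fun g => ?_
  simp only [indicator, inv_mul_cancel_left]
  rfl

theorem exists_common_minorant {b b' : G → ℝ}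
    (hb0 : ∀ g, 0 ≤ b g) (hb0' : ∀ g, 0 ≤ b' g) (hi : Integrable b Measure.haar)
    (hi' : Integrable b' Measure.haar) (h1 : ∫ g, b g ∂Measure.haar = 1) (s : G) :
    ∃ κ : Measure G, κ ≤ Measure.haar.withDensity (fun g => ENNReal.ofReal (b g)) ∧
      κ ≤ (Measure.haar.withDensity fun g => ENNReal.ofReal (b' g)).map (s * ·) ∧
      1 - ∫ g, |b (s * g) - b' g| ∂Measure.haar ≤ κ.real univ := by
  -- The minimum of the two densities, by left invariance of `haar`; its mass is estimated from `min
  -- u v ≥ u - |u - v|`.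
  refine ⟨Measure.haar.withDensity fun g => ENNReal.ofReal (min (b g) (b' (s⁻¹ * g))),
    withDensity_mono (.of_forall fun g => ENNReal.ofReal_le_ofReal (min_le_left _ _)), ?_, ?_⟩
  · rw [map_mul_left_withDensity]
    exact withDensity_mono (.of_forall fun g => ENNReal.ofReal_le_ofReal (min_le_right _ _))
  · have hi'' : Integrable (fun g => b' (s⁻¹ * g)) Measure.haar := hi'.comp_mul_left s⁻¹
    have hmin : Integrable (fun g => min (b g) (b' (s⁻¹ * g))) Measure.haar := hi.inf hi''
    have h2 : ∫ g, |b (s * g) - b' g| ∂Measure.haar =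
        ∫ g, |b g - b' (s⁻¹ * g)| ∂Measure.haar := by
      rw [← integral_mul_left_eq_self (fun g => |b g - b' (s⁻¹ * g)|) s]
      simp
    have hsub : Integrable (fun g => |b g - b' (s⁻¹ * g)|) Measure.haar := (hi.sub hi'').abs
    rw [h2, ← h1, ← integral_sub hi hsub, Measure.real,
      withDensity_apply _ .univ, Measure.restrict_univ,
      ← integral_eq_lintegral_of_nonneg_ae (.of_forall fun g => le_min (hb0 _) (hb0' _)) hmin.1]
    refine integral_mono (hi.sub hsub) hmin fun g => le_min ?_ ?_
    · exact sub_le_self _ (abs_nonneg _)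
    · have := le_abs_self (b g - b' (s⁻¹ * g))
      simp only
      linarith

end Amenability
-- Translates of functions in `𝓛^∞(X^p)`
section Translation

variable {𝕜 : Type*} [RCLike 𝕜] {n p : ℕ} {G X : Type*} [TopologicalSpace X]
  [ChartedSpace (EuclideanSpace ℝ (Fin n)) X] [Group G] [MulAction G X] [TopologicalSpace G]
  [ContinuousConstSMul G X] [IsManifold (𝓡 n) 1 X]

theorem isLebesgueMeasurable_comp_smul (h : IsC1Action n G X) (s : Fin p → G)
    {f : (Fin p → X) → 𝕜} (hf : IsLebesgueMeasurable (ModelPow n p) f) :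
    IsLebesgueMeasurable (ModelPow n p) fun x : Fin p → X => f fun j => s j • x j := by
  refine isLebesgueMeasurable_pow_iff.2 fun c hc => ?_
  set T : Set (Fin p → EuclideanSpace ℝ (Fin n)) := univ.pi fun j => (c j).target with hT
  let d : T → Fin p → OpenPartialHomeomorph X (EuclideanSpace ℝ (Fin n)) :=
    fun v j => chartAt _ (s j • (c j).symm (v.1 j))
  let τ : T → OpenPartialHomeomorph (Fin p → EuclideanSpace ℝ (Fin n))
      (Fin p → EuclideanSpace ℝ (Fin n)) :=
    fun v => OpenPartialHomeomorph.pi fun j => chartAction (s j) (c j) (d v j)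
  have hd : ∀ v j, d v j ∈ atlas (EuclideanSpace ℝ (Fin n)) X := fun v j => chart_mem_atlas _ _
  have hloc : ∀ v, AEMeasurable (fun y : Fin p → EuclideanSpace ℝ (Fin n) =>
      f fun j => s j • (c j).symm (y j)) (volume.restrict (τ v).source) := by
    intro v
    have hsm : MeasurableSet (τ v).source := (τ v).open_source.measurableSet
    have ham : AEMeasurable (τ v) (volume.restrict (τ v).source) :=
      (τ v).continuousOn.aemeasurable hsm
    have hmem : ∀ y ∈ (τ v).source, τ v y ∈ univ.pi fun j => (d v j).target :=
      fun y hy j _ => ((chartAction (s j) (c j) (d v j)).map_source (hy j trivial)).1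
    have hac : (volume.restrict (τ v).source).map (τ v) ≪
        volume.restrict (univ.pi fun j => (d v j).target) := by
      refine Measure.AbsolutelyContinuous.mk fun N hN hN0 => ?_
      rw [Measure.restrict_apply hN] at hN0
      rw [Measure.map_apply_of_aemeasurable ham hN, Measure.restrict_apply' hsm]
      refine measure_mono_null ?_ (measure_source_inter_preimage_eq_zero (τ v)
        (h.differentiableOn_pi_chartAction_symm G s hc (hd v)) hN0)
      rintro y ⟨hyN, hy⟩
      exact ⟨hy, hyN, hmem y hy⟩
    refine (((isLebesgueMeasurable_pow_iff.1 hf _ (hd v)).mono_ac hac).comp_aemeasurable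
      ham).congr ?_
    filter_upwards [ae_restrict_mem hsm] with y hy
    refine congrArg f (funext fun j => ?_)
    exact (d v j).left_inv (hy j trivial).2
  -- Measurability holds near each point of the chart target; the Lindelöf property of `(ℝⁿ)^p`
  -- reduces to countably many neighbourhoods.
  obtain ⟨A, hA, hAU⟩ := TopologicalSpace.isOpen_iUnion_countable (fun v => (τ v).source)
    fun v => (τ v).open_source
  have hsub : T ⊆ ⋃ v ∈ A, (τ v).source := by
    rw [hAU]
    intro v hv
    refine mem_iUnion.2 ⟨⟨v, hv⟩, fun j _ => ?_⟩
    exact ⟨hv j trivial, mem_chart_source _ _⟩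
  rw [biUnion_eq_iUnion] at hsub
  have : Countable A := hA.to_subtype
  exact (aemeasurable_iUnion_iff.2 fun v : A => hloc v).mono_measure (Measure.restrict_mono hsub le_rfl)

theorem comp_smul_mem_curlyLInftyPow (h : IsC1Action n G X) (s : Fin p → G)
    (f : CurlyLInftyPow 𝕜 n X p) :
    (fun x => f.1 fun j => s j • x j) ∈ CurlyLInftyPow 𝕜 n X p :=
  ⟨isLebesgueMeasurable_comp_smul h s f.2.1, f.2.2.choose, fun _ => f.2.2.choose_spec _⟩

end Translation

/-! ### The lifting as an ultrafilter limit -/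

section Limits

variable {𝕜 : Type*} [RCLike 𝕜] {I : Type*}

/-- Closed balls of `𝕜` are compact, so for bounded families `limUnder` is a true limit and not a
default value. -/
theorem tendsto_limUnder_of_norm_le {ι : Type*} (l : Ultrafilter ι) {a : ι → 𝕜} {C : ℝ}
    (h : ∀ r, ‖a r‖ ≤ C) : Tendsto a l (𝓝 (limUnder (l : Filter ι) a)) := by
  obtain ⟨z, -, hz⟩ := (isCompact_closedBall (0 : 𝕜) C).ultrafilter_le_nhds (l.map a)
    (by
      rw [le_principal_iff]
      exact Eventually.of_forall (f := (l : Filter ι)) fun r => by simpa using h r)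
  exact tendsto_nhds_limUnder ⟨z, hz⟩

theorem neBot_curry {α β : Type*} {l : Filter α} {m : Filter β} [l.NeBot] [m.NeBot] :
    (l.curry m).NeBot := by
  refine ⟨fun h => ?_⟩
  have : ∀ᶠ _r in l.curry m, False := by rw [h]; exact eventually_bot
  exact (eventually_curry_iff.1 this).exists.elim fun _ h' => h'.exists.elim fun _ h'' => h''

variable {n p : ℕ} {G X : Type*} [TopologicalSpace X]
  [ChartedSpace (EuclideanSpace ℝ (Fin n)) X] [Group G] [MulAction G X] [MeasurableSpace G]
  [TopologicalSpace G] [IsTopologicalGroup G] [ContinuousSMul G X] [BorelSpace G]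
  [IsManifold (𝓡 n) 1 X]

/-- The limit of the averages along an ultrafilter. -/
noncomputable def limAvg (S : I → SamplingFamily n G X) (l : Ultrafilter (I × ℝ))
    (f : (Fin p → X) → 𝕜) (x : Fin p → X) : 𝕜 :=
  limUnder (l : Filter (I × ℝ)) fun r => (S r.1).avg r.2 f x

variable {S : I → SamplingFamily n G X} {l : Ultrafilter (I × ℝ)} {m : Filter I}

omit [TopologicalSpace G] [IsTopologicalGroup G] [ContinuousSMul G X] [BorelSpace G]
  [IsManifold (𝓡 n) 1 X] in
theorem tendsto_limAvg (S : I → SamplingFamily n G X) (l : Ultrafilter (I × ℝ))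
    (f : CurlyLInftyPow 𝕜 n X p) (x : Fin p → X) :
    Tendsto (fun r : I × ℝ => (S r.1).avg r.2 f.1 x) l (𝓝 (limAvg S l f.1 x)) :=
  tendsto_limUnder_of_norm_le l (C := f.2.2.choose)
    fun r => (S r.1).norm_avg_le f.2.2.choose_spec r.2 x

theorem eventually_snd_pos (hl : (l : Filter (I × ℝ)) ≤ m.curry (𝓝[>] 0)) :
    ∀ᶠ r in (l : Filter (I × ℝ)), 0 < r.2 :=
  hl (eventually_curry_iff.2 (.of_forall fun _ => eventually_mem_nhdsWithin))

theorem tendsto_of_forall_tendsto (hl : (l : Filter (I × ℝ)) ≤ m.curry (𝓝[>] 0))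
    {E : Type*} [TopologicalSpace E] {a : I → ℝ → E} {z : E}
    (h : ∀ i, Tendsto (a i) (𝓝[>] 0) (𝓝 z)) :
    Tendsto (fun r : I × ℝ => a r.1 r.2) l (𝓝 z) :=
  (Tendsto.curry (.of_forall h)).mono_left hl

omit [TopologicalSpace G] [IsTopologicalGroup G] [ContinuousSMul G X] [BorelSpace G]
  [IsManifold (𝓡 n) 1 X] in
theorem limAvg_eq_of_forall_tendsto (hl : (l : Filter (I × ℝ)) ≤ m.curry (𝓝[>] 0))
    {f : CurlyLInftyPow 𝕜 n X p} {x : Fin p → X} {z : 𝕜}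
    (h : ∀ i, Tendsto (fun t => (S i).avg t f.1 x) (𝓝[>] 0) (𝓝 z)) : limAvg S l f.1 x = z :=
  tendsto_nhds_unique (tendsto_limAvg S l f x) (tendsto_of_forall_tendsto hl h)

theorem isNegligible_limAvg_ne (h : IsC1Action n G X)
    (hl : (l : Filter (I × ℝ)) ≤ m.curry (𝓝[>] 0)) (f : CurlyLInftyPow 𝕜 n X p) :
    IsNegligible (ModelPow n p) {x | limAvg S l f.1 x ≠ f.1 x} := by
  refine fun e he => measure_mono_null (inter_subset_inter_right _ (preimage_mono ?_))
    (SamplingFamily.isNegligible_not_tendsto_avg h f e he)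
  exact fun x hx hx' => hx (limAvg_eq_of_forall_tendsto hl fun i => hx' (S i))

/-- Ultrafilter limits of measurable functions need not be measurable; here the limit is, because it
equals `f` almost everywhere. -/
theorem limAvg_mem (h : IsC1Action n G X) (hl : (l : Filter (I × ℝ)) ≤ m.curry (𝓝[>] 0))
    (f : CurlyLInftyPow 𝕜 n X p) : limAvg S l f.1 ∈ CurlyLInftyPow 𝕜 n X p := by
  obtain ⟨hf, C, hC⟩ := f.2
  refine ⟨isLebesgueMeasurable_pow_iff.2 fun c hc => ?_, C, fun x => ?_⟩
  · refine (isLebesgueMeasurable_pow_iff.1 hf c hc).congr ?_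
    have h0 := isNegligible_pow_iff.1 (isNegligible_limAvg_ne (S := S) h hl f) c hc
    have hm : MeasurableSet (univ.pi fun j => (c j).target) :=
      (isOpen_set_pi finite_univ fun j _ => (c j).open_target).measurableSet
    rw [EventuallyEq, ae_restrict_iff' hm]
    filter_upwards [measure_eq_zero_iff_ae_notMem.1 h0] with v hv hvT
    by_contra hne
    exact hv ⟨fun j => hvT j trivial, fun h' => hne h'.symm⟩
  · exact le_of_tendsto (tendsto_limAvg S l f x).norm
      (.of_forall fun r => (S r.1).norm_avg_le hC r.2 x)

/-- The map `𝓛^∞(X^p) → 𝓛^∞(X^p)` sending a function to the limit of its averages. -/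
noncomputable def limAvgMap (h : IsC1Action n G X) (hl : (l : Filter (I × ℝ)) ≤ m.curry (𝓝[>] 0))
    (S : I → SamplingFamily n G X) (𝕜 : Type*) [RCLike 𝕜] (p : ℕ) :
    CurlyLInftyPow 𝕜 n X p →ₗ[𝕜] CurlyLInftyPow 𝕜 n X p where
  toFun f := ⟨limAvg S l f.1, limAvg_mem h hl f⟩
  map_add' f g := by
    refine Subtype.ext (funext fun x => ?_)
    refine tendsto_nhds_unique (tendsto_limAvg S l (f + g) x)
      (((tendsto_limAvg S l f x).add (tendsto_limAvg S l g x)).congr' ?_)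
    filter_upwards [eventually_snd_pos hl] with r hr
    exact (integral_add ((S r.1).integrable_point h hr.ne' x f)
      ((S r.1).integrable_point h hr.ne' x g)).symm
  map_smul' a f := by
    refine Subtype.ext (funext fun x => ?_)
    refine tendsto_nhds_unique (tendsto_limAvg S l (a • f) x)
      (((tendsto_limAvg S l f x).const_smul a).congr fun r => ?_)
    exact (integral_smul a _).symm

/-- Absolute continuity of the sampling laws makes the averages of a null function vanish at every
point for `t > 0`, so the limit depends only on the class. -/
theorem nullFunctions_le_ker_limAvgMap (h : IsC1Action n G X)
    (hl : (l : Filter (I × ℝ)) ≤ m.curry (𝓝[>] 0)) :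
    nullFunctions 𝕜 (ModelPow n p) (Fin p → X) ≤ LinearMap.ker (limAvgMap h hl S 𝕜 p) := by
  intro f hf
  refine Subtype.ext (funext fun x => ?_)
  refine tendsto_nhds_unique (tendsto_limAvg S l f x) (tendsto_const_nhds.congr' ?_)
  filter_upwards [eventually_snd_pos hl] with r hr
  refine (integral_eq_zero_of_ae ?_).symm
  filter_upwards [(S r.1).ae_notMem_of_isNegligible h hr.ne' x hf] with q hq
  simpa using hq

/-- The lifting `L^∞(X^p) → 𝓛^∞(X^p)` given by limits of averages. -/
noncomputable def limLifting (h : IsC1Action n G X) (hl : (l : Filter (I × ℝ)) ≤ m.curry (𝓝[>] 0))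
    (S : I → SamplingFamily n G X) (𝕜 : Type*) [RCLike 𝕜] (p : ℕ) :
    LInftyPow 𝕜 n X p →ₗ[𝕜] CurlyLInftyPow 𝕜 n X p :=
  (nullFunctions 𝕜 (ModelPow n p) (Fin p → X)).liftQ (limAvgMap h hl S 𝕜 p)
    (nullFunctions_le_ker_limAvgMap h hl)

theorem limLifting_strong (h : IsC1Action n G X)
    (hl : (l : Filter (I × ℝ)) ≤ m.curry (𝓝[>] 0)) (f : CurlyLInftyPow 𝕜 n X p)
    (hf : Continuous f.1) : limLifting h hl S 𝕜 p (cls f) = f :=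
  Subtype.ext (funext fun x => limAvg_eq_of_forall_tendsto hl fun i =>
    (S i).tendsto_avg_of_continuous h f hf x)

theorem isStrongLinearLifting_limLifting (h : IsC1Action n G X)
    (hl : (l : Filter (I × ℝ)) ≤ m.curry (𝓝[>] 0)) :
    IsStrongLinearLifting (limLifting h hl S 𝕜 p) where
  positive f hf x := by
    have hclosed : IsClosed {z : 𝕜 | 0 ≤ RCLike.re z ∧ RCLike.im z = 0} :=
      (isClosed_le continuous_const RCLike.continuous_re).inter
        (isClosed_eq RCLike.continuous_im continuous_const)
    refine hclosed.mem_of_tendsto (tendsto_limAvg S l f x) ?_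
    filter_upwards [eventually_snd_pos hl] with r hr
    have hi := (S r.1).integrable_point h hr.ne' x f
    have hae := (S r.1).ae_notMem_of_isNegligible h hr.ne' x hf
    constructor
    · rw [SamplingFamily.avg, ← integral_re hi]
      refine integral_nonneg_of_ae ?_
      filter_upwards [hae] with q hq
      exact (not_not.1 hq).1
    · rw [SamplingFamily.avg, ← integral_im hi]
      refine integral_eq_zero_of_ae ?_
      filter_upwards [hae] with q hq
      exact (not_not.1 hq).2
  lifts φ := by
    obtain ⟨f, rfl⟩ := Submodule.mkQ_surjective _ φ
    refine (Submodule.Quotient.eq _).2 ?_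
    refine fun e he => measure_mono_null (inter_subset_inter_right _ (preimage_mono ?_))
      (isNegligible_limAvg_ne (S := S) h hl f e he)
    exact fun x hx => sub_ne_zero.1 hx
  map_one := congrArg Subtype.val (limLifting_strong h hl _ continuous_const)
  strong := limLifting_strong h hl

/-- Covers permutations and, with `σ` skipping one index, the terms of the coboundary. -/
theorem limLifting_reindexClass (h : IsC1Action n G X)
    (hl : (l : Filter (I × ℝ)) ≤ m.curry (𝓝[>] 0)) {q : ℕ} (σ : Fin p ↪ Fin q)
    (φ : LInftyPow 𝕜 n X p) :
    limLifting h hl S 𝕜 q (reindexClass 𝕜 n X σ φ) =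
      reindex 𝕜 n X σ (limLifting h hl S 𝕜 p φ) := by
  obtain ⟨f, rfl⟩ := Submodule.mkQ_surjective _ φ
  refine Subtype.ext (funext fun x => sub_eq_zero.1 ?_)
  exact tendsto_nhds_unique ((tendsto_limAvg S l (reindex 𝕜 n X σ f) x).sub
    (tendsto_limAvg S l f fun i => x (σ i)))
    (tendsto_of_forall_tendsto hl fun i => (S i).tendsto_avg_comp_embedding_sub h σ f x)

theorem limLifting_coboundaryClass (h : IsC1Action n G X)
    (hl : (l : Filter (I × ℝ)) ≤ m.curry (𝓝[>] 0)) (φ : LInftyPow 𝕜 n X p) :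
    limLifting h hl S 𝕜 (p + 1) (coboundaryClass 𝕜 n X p φ) =
      coboundary 𝕜 n X p (limLifting h hl S 𝕜 p φ) := by
  simp only [coboundaryClass, coboundary, LinearMap.sum_apply, LinearMap.smul_apply, map_sum,
    map_smul, limLifting_reindexClass]

theorem isPowEquivariant_limLifting (h : IsC1Action n G X)
    (hl : (l : Filter (I × ℝ)) ≤ m.curry (𝓝[>] 0))
    (hκ : ∀ (s : G) (x : X), ∃ κ : I → Measure G, (∀ i, κ i ≤ (S i).meas x) ∧
      (∀ i, κ i ≤ ((S i).meas (s⁻¹ • x)).map (s * ·)) ∧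
      Tendsto (fun i => (κ i).real univ) m (𝓝 1)) :
    IsPowEquivariant G (limLifting h hl S 𝕜 p) := by
  intro s f
  have hmem := comp_smul_mem_curlyLInftyPow h (fun j => (s j)⁻¹) f
  refine ⟨hmem, fun x => sub_eq_zero.1 ?_⟩
  obtain ⟨-, C, hC⟩ := f.2
  have hC0 : 0 ≤ C := (norm_nonneg _).trans (hC x)
  choose κ h1 h2 h3 using fun j => hκ (s j) (x j)
  refine tendsto_nhds_unique ((tendsto_limAvg S l ⟨_, hmem⟩ x).sub
    (tendsto_limAvg S l f fun j => (s j)⁻¹ • x j)) (Tendsto.mono_left ?_ hl)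
  rw [Metric.tendsto_nhds]
  intro ε hε
  -- Iterated form: for `i` far enough, the `κ` term is below `ε / 2`; then, for this `i`, small `t`
  -- costs at most another `ε / 2`.
  rw [eventually_curry_iff]
  have hlim : Tendsto (fun i => 2 * C * (1 - ∏ j, (κ j i).real univ)) m (𝓝 0) := by
    have := ((tendsto_finsetProd Finset.univ fun j _ => h3 j).const_sub 1).const_mul (2 * C)
    simpa using this
  filter_upwards [hlim.eventually_lt_const (half_pos hε)] with i hi
  filter_upwards [(S i).eventually_norm_avg_sub_le h s x (fun j => h1 j i) (fun j => h2 j i) f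
    ⟨_, hmem⟩ (fun _ => rfl) hC0 hC (ε := ε / 2) (half_pos hε)] with t ht
  rw [dist_zero_right]
  linarith

end Limits

/-! ### Sampling families from the amenability net, and conclusion -/

theorem exists_samplingFamily (n : ℕ)
    {G : Type u} [TopologicalSpace G] [Group G] [IsTopologicalGroup G] [LocallyCompactSpace G]
    [MeasurableSpace G] [BorelSpace G]
    {X : Type v} [TopologicalSpace X] [T2Space X] [ParacompactSpace X]
    [ChartedSpace (EuclideanSpace ℝ (Fin n)) X] [MulAction G X] [ContinuousSMul G X]
    {I : Type w} {μ : I → G → X → ℝ} (hc : ∀ i, Continuous fun q : G × X => μ i q.1 q.2)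
    (hi : ∀ i x, ∫ g, μ i g x ∂Measure.haar = 1) (h0 : ∀ i g x, 0 ≤ μ i g x) :
    ∃ S : I → SamplingFamily n G X, ∀ i x, (S i).meas x =
      Measure.haar.withDensity fun g => ENNReal.ofReal (μ i g x) := by
  obtain ⟨a, ha, ham, hac⟩ := exists_chart_selection X (EuclideanSpace ℝ (Fin n))
  have hint : ∀ i x, Integrable (fun g => μ i g x) Measure.haar := fun i x =>
    .of_integral_ne_zero (by rw [hi]; exact one_ne_zero)
  choose A hA hAm using fun i x => exists_countable_ae_mem (b := fun g => μ i g x) hac x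
    ((hc i).comp (Continuous.prodMk_left x)) (hint i x)
  refine ⟨fun i => ⟨a, ha, ham, A i, hA i, _, fun x => ⟨?_⟩, hAm i⟩, fun i x => rfl⟩
  rw [withDensity_apply _ .univ, Measure.restrict_univ,
    ← ofReal_integral_eq_lintegral_ofReal (hint i x) (.of_forall fun g => h0 i g x), hi,
    ENNReal.ofReal_one]

end EquivLifting

open EquivLifting
theorem mainTheorem4 (n : ℕ)
    (G : Type u) [TopologicalSpace G] [Group G] [IsTopologicalGroup G] [LocallyCompactSpace G]
    [MeasurableSpace G] [BorelSpace G]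
    (X : Type v) [TopologicalSpace X] [T2Space X] [ParacompactSpace X]
    [ChartedSpace (EuclideanSpace ℝ (Fin n)) X] [IsManifold (𝓡 n) 1 X]
    [MulAction G X] [ContinuousSMul G X]
    (hC1 : IsC1Action n G X) (hamen : IsAmenableAction.{u, v, w} G X)
    (𝕜 : Type k) [RCLike 𝕜] :
    ∃ L : ∀ p : ℕ, LInftyPow 𝕜 n X p →ₗ[𝕜] CurlyLInftyPow 𝕜 n X p,
      (∀ p, IsStrongLinearLifting (L p)) ∧
      (∀ p, IsPowEquivariant G (L p)) ∧
      (∀ (p : ℕ) (σ : Equiv.Perm (Fin p)) (φ : LInftyPow 𝕜 n X p),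
        L p (reindexClass 𝕜 n X σ.toEmbedding φ) = reindex 𝕜 n X σ.toEmbedding (L p φ)) ∧
      (∀ (p : ℕ) (φ : LInftyPow 𝕜 n X p),
        L (p + 1) (coboundaryClass 𝕜 n X p φ) = coboundary 𝕜 n X p (L p φ)) := by
  obtain ⟨I, _, _, _, μ, hc, h0, hi, hlim⟩ := hamen
  obtain ⟨S, hS⟩ := exists_samplingFamily n hc hi h0
  -- In `curry`, how small `t` must be may depend on `i`.
  have hne : ((atTop : Filter I).curry (𝓝[>] (0 : ℝ))).NeBot := neBot_curry
  let l := Ultrafilter.of ((atTop : Filter I).curry (𝓝[>] (0 : ℝ)))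
  have hl : (l : Filter (I × ℝ)) ≤ (atTop : Filter I).curry (𝓝[>] 0) := Ultrafilter.of_le _
  refine ⟨limLifting hC1 hl S 𝕜, fun p => isStrongLinearLifting_limLifting hC1 hl,
    fun p => isPowEquivariant_limLifting hC1 hl fun s x => ?_,
    fun p σ φ => limLifting_reindexClass hC1 hl _ φ,
    fun p φ => limLifting_coboundaryClass hC1 hl φ⟩
  have hint : ∀ i x, Integrable (fun g => μ i g x) Measure.haar := fun i x =>
    .of_integral_ne_zero (by rw [hi]; exact one_ne_zero)
  choose κ h1 h2 h3 using fun i => exists_common_minorant (h0 i · x) (h0 i · (s⁻¹ • x))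
    (hint i x) (hint i (s⁻¹ • x)) (hi i x) s
  refine ⟨κ, fun i => (h1 i).trans_eq (hS i x).symm, fun i => ?_, ?_⟩
  · rw [hS]
    exact h2 i
  -- Evaluation at `(s, s⁻¹ • x)`, so that `s • s⁻¹ • x = x` yields the integral in
  -- `exists_common_minorant`.
  · have ht := (hlim {(s, s⁻¹ • x)} isCompact_singleton).tendsto_at (mem_singleton _)
    simp only [smul_inv_smul] at ht
    have ht' := ht.const_sub 1
    rw [sub_zero] at ht'
    refine tendsto_of_tendsto_of_tendsto_of_le_of_le ht' tendsto_const_nhds h3 fun i => ?_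
    have hp : IsProbabilityMeasure ((S i).meas x) := inferInstance
    rw [hS] at hp
    exact ENNReal.toReal_le_of_le_ofReal zero_le_one
      (by simpa using ((h1 i) univ).trans prob_le_one)
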